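/- Let $\sigma$ be the surface measure on $S^2\subset\mathbb R^3$ (total mass $4\pi$), let $L^q(S^2)$ be the spaces of real functions with respect to $\sigma$, and let $Q_m$ be the orthogonal projection of $L^2(S^2)$ onto the spherical harmonics of degree $m$. For $R>1$ let $$Tf=\sum_{m=0}^\infty\frac{(m+1)(m+2)}{R^{m+3}}\,Q_mf,\qquad f\in L^2(S^2),$$ be the forward operator of satellite gradiometry (it maps the boundary values $f$ on $S^2$ of a potential $u$, harmonic outside the unit ball and vanishing at infinity, to $\partial^2u/\partial r^2$ on the sphere of radius $R$). Let $p>0$ and let $f^\dagger\in H^p(S^2)$, i.e. $f^\dagger\in L^2(S^2)$ and $\sum_m(1+m(m+1))^p\|Q_mf^\dagger\|_{L^2}^2<\infty$. For $\varepsilon\ge 0$, $\eta>0$ we say that $\xi\in L^1(S^2)$ satisfies the noise model with parameters $(\varepsilon,\eta)$ if there is a Borel set $P\subset S^2$ with $\|\xi\|_{L^1(S^2\setminus P)}\le\varepsilon$ and $\sigma(P)\le\eta$. For $\alpha>0$ let $\hat f_\alpha$ denote any minimizer over $f\in L^2(S^2)$ of $$\frac1\alpha\|Tf-g^{\rm obs}\|_{L^1(S^2)}+\|f\|_{L^2(S^2)}^2,\qquad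 g^{\rm obs}=Tf^\dagger+\xi .$$ (a) There are $C>0$, $\eta_0>0$ and $\alpha_0\in(0,1)$, depending only on $R$, $p$ and $f^\dagger$, such that for all $0<\eta\le\eta_0$, $\varepsilon\ge0$, $0<\alpha\le\alpha_0$, all $\xi\in L^1(S^2)$ satisfying the noise model with parameters $(\varepsilon,\eta)$, and all minimizers $\hat f_\alpha$, $$\|\hat f_\alpha-f^\dagger\|_{L^2}^2\le C\Big(\frac\varepsilon\alpha+\frac1{\alpha^2}\frac1{R^6}\eta^{-3}R^{-2\sqrt{\pi/\eta}}+(-\ln\alpha)^{-2p}\Big),$$ $$\|T\hat f_\alpha-Tf^\dagger\|_{L^1}\le C\Big(\varepsilon+\frac1\alpha\frac1{R^6}\eta^{-3}R^{-2\sqrt{\pi/\eta}}+\alpha(-\ln\alpha)^{-2p}\Big).$$ (b) There is a parameter choice $\bar\alpha=\bar\alpha(\varepsilon,\eta)$ with $\bar\alpha(\varepsilon,\eta)\to0$ as $\varepsilon,\eta\searrow0$, and there are $K,\varepsilon_1,\eta_1>0$, such that for all $0\le\varepsilon\le\varepsilon_1$ and $0<\eta\le\eta_1$ one has $\bar\alpha>0$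 and $$\sqrt{\frac{2\varepsilon}{\bar\alpha}}+\frac{2\eta\,\gamma(2\eta)}{\bar\alpha}\le K,\qquad \gamma(\delta):=\delta^{-5/2}R^{-\sqrt{4\pi/\delta}-4},$$ and for all $\xi\in L^1(S^2)$ satisfying the noise model with parameters $(\varepsilon,\eta)$ and all minimizers $\hat f_{\bar\alpha}$, $$\|\hat f_{\bar\alpha}-f^\dagger\|_{L^2}^2\le K\max\{(-\ln\varepsilon)^{-2p},\,\eta^p\},$$ $$\|T\hat f_{\bar\alpha}-Tf^\dagger\|_{L^1}\le K\max\{\varepsilon,\,\eta^{\frac{2p-3}2}R^{-\sqrt{\pi/\eta}}\},$$ where $(-\ln\varepsilon)^{-2p}:=0$ for $\varepsilon=0$. -/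

import Mathlib

open MeasureTheory

namespace Gradiometry

/-- The unit sphere `S²` in Euclidean three-space. -/
abbrev S2 : Type := Metric.sphere (0 : EuclideanSpace ℝ (Fin 3)) 1

/-- The (unnormalized) surface measure on `S²`, of total mass `4π`. -/
noncomputable def surf : Measure S2 :=
  (volume : Measure (EuclideanSpace ℝ (Fin 3))).toSphere

instance : IsFiniteMeasure surf :=
  inferInstanceAs (IsFiniteMeasure (volume : Measure (EuclideanSpace ℝ (Fin 3))).toSphere)

/-- The real Hilbert space `L²(S²)`. -/
abbrev L2 : Type := Lp ℝ 2 surf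

/-- The Laplacian on real polynomials in three variables. -/
noncomputable def polyLaplacian : MvPolynomial (Fin 3) ℝ →ₗ[ℝ] MvPolynomial (Fin 3) ℝ :=
  ∑ i : Fin 3, (MvPolynomial.pderiv i).toLinearMap ∘ₗ (MvPolynomial.pderiv i).toLinearMap

/-- The harmonic polynomials in three variables that are homogeneous of degree `m`. -/
noncomputable def harmonicPoly (m : ℕ) : Submodule ℝ (MvPolynomial (Fin 3) ℝ) :=
  MvPolynomial.homogeneousSubmodule (Fin 3) ℝ m ⊓ LinearMap.ker polyLaplacian

/-- Restriction of a polynomial to the sphere, as a continuous function. -/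
noncomputable def restrictPoly : MvPolynomial (Fin 3) ℝ →ₐ[ℝ] C(S2, ℝ) :=
  MvPolynomial.aeval fun i =>
    (⟨fun x => (x : EuclideanSpace ℝ (Fin 3)) i, by fun_prop⟩ : C(S2, ℝ))

theorem restrictPoly_apply (P : MvPolynomial (Fin 3) ℝ) (x : S2) :
    restrictPoly P x =
      MvPolynomial.eval (fun i => (x : EuclideanSpace ℝ (Fin 3)) i) P := by
  induction P using MvPolynomial.induction_on with
  | C a => simp [restrictPoly, algebraMap_apply]
  | add p q hp hq => simp [hp, hq]
  | mul_X p i hp => rw [map_mul, ContinuousMap.mul_apply, hp]; simp [restrictPoly]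

/-- The space `𝓗_m` of spherical harmonics of degree `m`, as a subspace of `L²(S²)`. -/
noncomputable def sphHarm (m : ℕ) : Submodule ℝ L2 :=
  (harmonicPoly m).map
    ((ContinuousMap.toLp (E := ℝ) 2 surf ℝ).toLinearMap ∘ₗ restrictPoly.toLinearMap)

instance (m : ℕ) : FiniteDimensional ℝ (sphHarm m) := by
  have h1 : FiniteDimensional ℝ (MvPolynomial.homogeneousSubmodule (Fin 3) ℝ m) :=
    Module.Finite.iff_fg.mpr (MvPolynomial.homogeneousSubmodule_fg (σ := Fin 3) (R := ℝ) m)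
  have h2 : FiniteDimensional ℝ (harmonicPoly m) :=
    Submodule.finiteDimensional_inf_left _ _
  unfold sphHarm
  infer_instance

/-- The orthogonal projection `Q_m` of `L²(S²)` onto `𝓗_m`. -/
noncomputable def Q (m : ℕ) : L2 →L[ℝ] L2 := (sphHarm m).starProjection

/-- The singular values `(m+1)(m+2) / R^(m+3)` of the gradiometry operator. -/
noncomputable def coeff (R : ℝ) (m : ℕ) : ℝ := ((m : ℝ) + 1) * ((m : ℝ) + 2) / R ^ (m + 3)

/-- The forward operator of satellite gradiometry at orbit radius `R > 1`: it maps the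
boundary value `f` of the exterior harmonic potential `u = ∑ₘ r^(-m-1) Q_m f` to `∂²u/∂r²`
at `r = R`, that is `T f = ∑ₘ (m+1)(m+2) R^(-m-3) Q_m f` (convergent in `L²(S²)`). -/
noncomputable def T (R : ℝ) (f : L2) : L2 := ∑' m : ℕ, coeff R m • Q m f

/-- The series that defines `T R f` converges. -/
theorem summable_T {R : ℝ} (hR : 1 < R) (f : L2) :
    Summable fun m : ℕ => coeff R m • Q m f := by
  have hR0 : 0 < R := by linarith
  have hr : ‖R⁻¹‖ < 1 := by
    rw [Real.norm_of_nonneg (by positivity)]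
    exact inv_lt_one_of_one_lt₀ hR
  have h0 := summable_pow_mul_geometric_of_norm_lt_one 0 hr
  have h1 := summable_pow_mul_geometric_of_norm_lt_one 1 hr
  have h2 := summable_pow_mul_geometric_of_norm_lt_one 2 hr
  have hc : Summable fun m : ℕ => coeff R m := by
    refine ((((h2.add (h1.mul_left 3)).add (h0.mul_left 2)).mul_left (R ^ 3)⁻¹)).congr ?_
    intro m
    simp only [coeff, inv_pow]
    field_simp
    ring
  refine Summable.of_norm_bounded (hc.mul_right ‖f‖) fun m => ?_
  have hn : 0 ≤ coeff R m := by unfold coeff; positivity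
  rw [norm_smul, Real.norm_of_nonneg hn]
  exact mul_le_mul_of_nonneg_left (Submodule.norm_starProjection_apply_le _ f) hn

/-- Membership in the Sobolev space `H^p(S²)`: the expansion of `f` in spherical harmonics
satisfies `∑ₘ (1 + m(m+1))^p ‖Q_m f‖² < ∞` (`m(m+1)` are the eigenvalues of the negative
Laplace-Beltrami operator). -/
def MemSobolev (p : ℝ) (f : L2) : Prop :=
  Summable fun m : ℕ => (1 + (m : ℝ) * ((m : ℝ) + 1)) ^ p * ‖Q m f‖ ^ 2

/-- The impulsive noise model: outside a Borel set of surface measure at most `η`, the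
`L¹`-norm of `ξ` is at most `ε`. -/
def ImpulsiveNoise (ξ : S2 → ℝ) (ε η : ℝ) : Prop :=
  ∃ P : Set S2, MeasurableSet P ∧ (∫ x in Pᶜ, |ξ x| ∂surf) ≤ ε ∧ surf P ≤ ENNReal.ofReal η

/-- The Tikhonov functional `f ↦ (1/α) ‖T f - g‖_{L¹} + ‖f‖²_{L²}`. -/
noncomputable def tikhonov (R α : ℝ) (g : S2 → ℝ) (f : L2) : ℝ :=
  1 / α * (∫ x, |T R f x - g x| ∂surf) + ‖f‖ ^ 2

/-- `fhat` minimizes the Tikhonov functional over `L²(S²)`. -/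
def IsTikhonovMinimizer (R α : ℝ) (g : S2 → ℝ) (fhat : L2) : Prop :=
  IsMinOn (tikhonov R α g) Set.univ fhat

/-- The smoothing function `γ(δ) = δ^(-5/2) R^(-√(4π/δ) - 4)` of the gradiometry operator. -/
noncomputable def smoothing (R δ : ℝ) : ℝ :=
  δ ^ (-(5 / 2) : ℝ) * R ^ (-√(4 * Real.pi / δ) - 4)

end Gradiometry

namespace Gradiometry

/-! Put h = fhat - fdag. Comparing the Tikhonov functional at fhat and at fdag, and splitting the
sphere into P and its complement, leaves ‖Th‖₁ + α(‖h‖² + 2⟨fdag, h⟩) ≤ 2ε + 2∫_P |Th|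
(`tikhonov_basic_estimate`); the size of the noise on P has dropped out. Two terms remain to be
absorbed.

The integral over P is controlled because Th is almost a polynomial. The polynomials of degree at
most N form a rotation-invariant space of dimension at most (N+1)², so the projection onto them maps
L¹ to L^∞ with norm at most (N+1)²/(4π), while the tail of Th decays almost like R^(-N). For N of
order √(π/η) the polynomial part costs a fixed fraction of ‖Th‖₁ and the tail is exponentially small
(`exists_setIntegral_T_le`).

The inner product ⟨fdag, h⟩ is cut at a degree M close to -log α / (2 log R). Below M, inverting T
costs about R^M, that is α^(-1/2); above M, Sobolev smoothness gives (-log α)^(-p)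
(`exists_inner_le`).

Young's inequality absorbs the terms linear in ‖h‖ (`exists_tikhonov_error_le`). The impulsive term
comes out with exponent 11/5 instead of 2; the surplus pays for all powers of η in the convergence
rates, where `paramChoice` keeps both ε/α and the impulsive quotient under control.

The facts on spherical harmonics rest on rotation invariance: differentiating it yields the
divergence theorem on polynomials and hence orthogonality, while P = H + |x|²S together with
Stone-Weierstrass yields completeness. -/

/-- Euclidean three-space. -/
abbrev E3 : Type := EuclideanSpace ℝ (Fin 3)

/-! ### Rotation invariance of the surface measure -/

/-- The action of a linear isometry on the sphere. -/
noncomputable def sphereMap (ρ : E3 ≃ₗᵢ[ℝ] E3) (x : S2) : S2 :=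
  ⟨ρ x, by simp⟩

theorem continuous_sphereMap (ρ : E3 ≃ₗᵢ[ℝ] E3) : Continuous (sphereMap ρ) :=
  Continuous.subtype_mk (ρ.continuous.comp continuous_subtype_val) _

open Pointwise in
-- The surface measure of s is a multiple of the volume of the cone over s, and a linear isometry
-- maps cones to cones and preserves volume.
theorem surf_preimage_sphereMap (ρ : E3 ≃ₗᵢ[ℝ] E3) {s : Set S2} (hs : MeasurableSet s) :
    surf (sphereMap ρ ⁻¹' s) = surf s := by
  rw [surf, Measure.toSphere_apply' _ hs,
    Measure.toSphere_apply' _ ((continuous_sphereMap ρ).measurable hs)]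
  have : Set.Ioo (0 : ℝ) 1 • ((↑) '' (sphereMap ρ ⁻¹' s) : Set E3)
      = ρ ⁻¹' (Set.Ioo (0 : ℝ) 1 • ((↑) '' s : Set E3)) := by
    ext y
    simp only [Set.mem_smul, Set.mem_image, Set.mem_preimage]
    constructor
    · rintro ⟨r, hr, _, ⟨x, hx, rfl⟩, rfl⟩
      exact ⟨r, hr, _, ⟨_, hx, rfl⟩, by simp [sphereMap]⟩
    · rintro ⟨r, hr, _, ⟨x, hx, rfl⟩, h⟩
      refine ⟨r, hr, _, ⟨sphereMap ρ.symm x, ?_, rfl⟩, ?_⟩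
      · simpa [sphereMap] using hx
      · apply ρ.injective
        simpa [sphereMap] using h
  have hpre := ρ.measurePreserving.measure_preimage_equiv (f := ρ.toMeasurableEquiv)
    (Set.Ioo (0 : ℝ) 1 • ((↑) '' s : Set E3))
  rw [this]
  exact congrArg _ hpre

theorem measurePreserving_sphereMap (ρ : E3 ≃ₗᵢ[ℝ] E3) :
    MeasurePreserving (sphereMap ρ) surf surf := by
  refine ⟨(continuous_sphereMap ρ).measurable, ?_⟩
  ext s hs
  rw [Measure.map_apply (continuous_sphereMap ρ).measurable hs, surf_preimage_sphereMap ρ hs]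

theorem integral_comp_sphereMap (ρ : E3 ≃ₗᵢ[ℝ] E3) (f : C(S2, ℝ)) :
    ∫ x, f (sphereMap ρ x) ∂surf = ∫ x, f x ∂surf := by
  have h := (measurePreserving_sphereMap ρ).map_eq
  conv_rhs => rw [← h]
  rw [integral_map (continuous_sphereMap ρ).aemeasurable]
  rw [h]
  exact f.continuous.aestronglyMeasurable

theorem exists_sphereMap_eq (x y : S2) : ∃ ρ, sphereMap ρ x = y := by
  -- The reflection in the plane orthogonal to x - y exchanges two vectors of equal norm.
  refine ⟨(Submodule.span ℝ {(x : E3) - y})ᗮ.reflection, Subtype.ext ?_⟩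
  exact Submodule.reflection_sub (by simp)

theorem integrable_continuousMap (f : C(S2, ℝ)) : Integrable f surf :=
  f.continuous.integrable_of_hasCompactSupport (HasCompactSupport.of_compactSpace f)

instance : surf.IsOpenPosMeasure :=
  inferInstanceAs (volume : Measure E3).toSphere.IsOpenPosMeasure

theorem surf_univ : surf.real Set.univ = 4 * Real.pi := by
  rw [surf, Measure.toSphere_real_apply_univ, measureReal_def, EuclideanSpace.volume_ball_fin_three]
  simp
  rw [ENNReal.toReal_ofReal (by positivity)]
  ring

/-! ### Integration of polynomials over the sphere and the divergence theorem -/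

open MvPolynomial

theorem hasDerivAt_eval (P : MvPolynomial (Fin 3) ℝ) {y : ℝ → Fin 3 → ℝ} {y' : Fin 3 → ℝ} {t : ℝ}
    (hy : ∀ i, HasDerivAt (fun s => y s i) (y' i) t) :
    HasDerivAt (fun s => eval (y s) P) (∑ k, eval (y t) (pderiv k P) * y' k) t := by
  induction P using MvPolynomial.induction_on with
  | C a => simpa using hasDerivAt_const t a
  | add p q hp hq =>
    simp only [map_add, add_mul, Finset.sum_add_distrib]
    exact hp.add hq
  | mul_X p i hp =>
    have := hp.mul (hy i)
    simp only [map_mul, eval_X]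
    refine this.congr_deriv ?_
    simp only [Derivation.leibniz, pderiv_X, smul_eq_mul, map_add, map_mul, eval_X, add_mul,
      Finset.sum_add_distrib]
    rw [add_comm]
    congr 1
    · rw [Finset.sum_eq_single i]
      · simp
      · intro b _ hb
        simp [hb.symm]
      · simp
    · rw [Finset.sum_mul]
      exact Finset.sum_congr rfl fun k _ => by ring

/-- The linear map rotating the `(i, j)`-plane by the angle `t`. -/
noncomputable def planeRotationLin (i j : Fin 3) (t : ℝ) : E3 →ₗ[ℝ] E3 where
  toFun x := x + ((Real.cos t - 1) * x i - Real.sin t * x j) • EuclideanSpace.single i (1 : ℝ)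
    + (Real.sin t * x i + (Real.cos t - 1) * x j) • EuclideanSpace.single j (1 : ℝ)
  map_add' x y := by
    ext k; simp; split_ifs <;> ring
  map_smul' c x := by
    ext k; simp; split_ifs <;> ring

theorem norm_planeRotationLin {i j : Fin 3} (hij : i ≠ j) (t : ℝ) (x : E3) :
    ‖planeRotationLin i j t x‖ = ‖x‖ := by
  have h := Real.sin_sq_add_cos_sq t
  rw [← sq_eq_sq₀ (norm_nonneg _) (norm_nonneg _), EuclideanSpace.real_norm_sq_eq,
    EuclideanSpace.real_norm_sq_eq]
  fin_cases i <;> fin_cases j <;> simp [planeRotationLin, Fin.sum_univ_three] at hij ⊢ <;>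
    first
    | linear_combination (x.ofLp 0 ^ 2 + x.ofLp 1 ^ 2) * h
    | linear_combination (x.ofLp 0 ^ 2 + x.ofLp 2 ^ 2) * h
    | linear_combination (x.ofLp 1 ^ 2 + x.ofLp 2 ^ 2) * h

/-- The rotation of the `(i, j)`-plane by the angle `t`. -/
noncomputable def planeRotation {i j : Fin 3} (hij : i ≠ j) (t : ℝ) : E3 ≃ₗᵢ[ℝ] E3 :=
  LinearIsometry.toLinearIsometryEquiv ⟨planeRotationLin i j t, norm_planeRotationLin hij t⟩ rfl

theorem planeRotation_apply {i j : Fin 3} (hij : i ≠ j) (t : ℝ) (x : E3) (k : Fin 3) :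
    planeRotation hij t x k = x k + ((Real.cos t - 1) * x i - Real.sin t * x j) * (if k = i then 1 else 0)
      + (Real.sin t * x i + (Real.cos t - 1) * x j) * (if k = j then 1 else 0) := by
  change planeRotationLin i j t x k = _
  simp [planeRotationLin]

/-- The integral over the sphere, as a linear functional on polynomials. -/
noncomputable def sphInt : MvPolynomial (Fin 3) ℝ →ₗ[ℝ] ℝ where
  toFun P := ∫ x, restrictPoly P x ∂surf
  map_add' P Q := by
    simp only [map_add, ContinuousMap.add_apply]
    exact integral_add (integrable_continuousMap _) (integrable_continuousMap _)
  map_smul' c P := by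
    simp only [map_smul, ContinuousMap.smul_apply]
    exact integral_smul _ _

theorem sphInt_apply (P : MvPolynomial (Fin 3) ℝ) :
    sphInt P = ∫ x, restrictPoly P x ∂surf := rfl

theorem hasDerivAt_integral_eval (P : MvPolynomial (Fin 3) ℝ) {y y' : ℝ → S2 → Fin 3 → ℝ}
    (hy : ∀ t x k, HasDerivAt (fun s => y s x k) (y' t x k) t)
    (hc : Continuous fun q : ℝ × S2 => y q.1 q.2) (hc' : Continuous fun q : ℝ × S2 => y' q.1 q.2) :
    HasDerivAt (fun t => ∫ x, eval (y t x) P ∂surf)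
      (∫ x, ∑ k, eval (y 0 x) (pderiv k P) * y' 0 x k ∂surf) 0 := by
  have hF'cont : Continuous fun q : ℝ × S2 =>
      ∑ k, eval (y q.1 q.2) (pderiv k P) * y' q.1 q.2 k :=
    continuous_finsetSum _ fun k _ => ((MvPolynomial.continuous_eval _).comp hc).mul
      ((continuous_apply k).comp hc')
  obtain ⟨B, hB⟩ := ((isCompact_Icc (a := (-1 : ℝ)) (b := 1)).prod
    (isCompact_univ (X := S2))).exists_bound_of_continuousOn hF'cont.continuousOn
  have hs : ∀ t : ℝ, Continuous fun x : S2 => (t, x) := fun t => by fun_prop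
  have hcF : ∀ t, Continuous fun x : S2 => eval (y t x) P := fun t =>
    (MvPolynomial.continuous_eval P).comp (hc.comp (hs t))
  exact (hasDerivAt_integral_of_dominated_loc_of_deriv_le (μ := surf)
    (F := fun t x => eval (y t x) P) (x₀ := 0) (s := Set.Icc (-1) 1)
    (F' := fun t x => ∑ k, eval (y t x) (pderiv k P) * y' t x k)
    (bound := fun _ => B) (Icc_mem_nhds (by norm_num) (by norm_num))
    (Filter.Eventually.of_forall fun t => (hcF t).aestronglyMeasurable)
    (integrable_continuousMap ⟨_, hcF 0⟩)
    (hF'cont.comp (hs 0)).aestronglyMeasurable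
    (Filter.Eventually.of_forall fun x t ht => hB (t, x) ⟨ht, trivial⟩)
    (integrable_const _)
    (Filter.Eventually.of_forall fun x t _ => hasDerivAt_eval P (hy t x))).2

theorem integral_eval_planeRotation {i j : Fin 3} (hij : i ≠ j) (t : ℝ)
    (P : MvPolynomial (Fin 3) ℝ) :
    ∫ x : S2, eval (fun k => planeRotation hij t (x : E3) k) P ∂surf = sphInt P := by
  rw [sphInt_apply, ← integral_comp_sphereMap (planeRotation hij t)]
  refine integral_congr_ae (Filter.Eventually.of_forall fun x => ?_)
  simp only [restrictPoly_apply]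
  rfl

/-- Integrals of polynomials along infinitesimal rotations vanish. -/
theorem sphInt_rotation_generator (i j : Fin 3) (P : MvPolynomial (Fin 3) ℝ) :
    sphInt (X i * pderiv j P) = sphInt (X j * pderiv i P) := by
  rcases eq_or_ne i j with rfl | hij
  · rfl
  have key := hasDerivAt_integral_eval P
    (y := fun t x k => planeRotation hij t (x : E3) k)
    (y' := fun t x k =>
      (-Real.sin t * (x : E3) i - Real.cos t * (x : E3) j) * (if k = i then 1 else 0)
        + (Real.cos t * (x : E3) i + -Real.sin t * (x : E3) j) * (if k = j then 1 else 0))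
    (by
      intro t x k
      simp only [planeRotation_apply]
      have hc := (Real.hasDerivAt_cos t).sub_const 1
      have hs := Real.hasDerivAt_sin t
      exact ((((hc.mul_const _).sub (hs.mul_const _)).mul_const _).const_add _).add
        (((hs.mul_const _).add (hc.mul_const _)).mul_const _))
    (by
      refine continuous_pi fun k => ?_
      simp only [planeRotation_apply]
      fun_prop)
    (by
      refine continuous_pi fun k => ?_
      fun_prop)
  simp only [integral_eval_planeRotation] at key
  -- The integral does not depend on the angle, so its derivative at angle 0 is zero; that
  -- derivative is the integral of the infinitesimal rotation.
  have h0 := key.unique (hasDerivAt_const 0 _)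
  have h1 : sphInt (X i * pderiv j P - X j * pderiv i P) = 0 := by
    rw [← h0, sphInt_apply]
    refine integral_congr_ae (Filter.Eventually.of_forall fun x => ?_)
    have hy0 : (fun k => planeRotation hij 0 (x : E3) k) = fun k => (x : E3) k := by
      funext k
      simp [planeRotation_apply]
    simp only [hy0]
    rw [restrictPoly_apply]
    simp only [map_sub, map_mul, eval_X]
    simp [mul_add, Finset.sum_add_distrib]
    ring
  rwa [map_sub, sub_eq_zero] at h1

theorem restrictPoly_sum_sq : restrictPoly (∑ i, X i ^ 2) = 1 := by
  ext x
  have h : ‖(x : E3)‖ ^ 2 = 1 := by simp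
  rw [EuclideanSpace.real_norm_sq_eq] at h
  rw [restrictPoly_apply]
  simpa using h

theorem sphInt_sum_sq_mul (P : MvPolynomial (Fin 3) ℝ) : sphInt ((∑ i, X i ^ 2) * P) = sphInt P := by
  rw [sphInt_apply, sphInt_apply, map_mul, restrictPoly_sum_sq, one_mul]

/-- The divergence theorem on the unit ball, for homogeneous polynomials. -/
theorem sphInt_X_mul {P : MvPolynomial (Fin 3) ℝ} {k : ℕ} (hP : P.IsHomogeneous k) (i : Fin 3) :
    (k + 2 : ℝ) * sphInt (X i * P) = sphInt (pderiv i P) := by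
  -- The rotation identity is applied to X j * P and summed over j. Euler's relation evaluates the
  -- left side, |x|² = 1 the right side; the difference of the coefficients k + 3 and 1 is the
  -- factor k + 2.
  have h : ∑ j, sphInt (X i * pderiv j (X j * P)) = ∑ j, sphInt (X j * pderiv i (X j * P)) :=
    Finset.sum_congr rfl fun j _ => sphInt_rotation_generator i j _
  rw [← map_sum, ← map_sum] at h
  have e1 : ∑ j, X i * pderiv j (X j * P) = (k + 3 : ℝ) • (X i * P) := by
    have hE := hP.sum_X_mul_pderiv
    simp only [Derivation.leibniz, pderiv_X_self, smul_eq_mul, mul_add, Finset.sum_add_distrib,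
      ← Finset.mul_sum, hE]
    simp only [Finset.sum_const, Finset.card_univ, Fintype.card_fin, nsmul_eq_mul, smul_eq_C_mul,
      map_add, map_natCast, mul_one]
    rw [show (C (3 : ℝ) : MvPolynomial (Fin 3) ℝ) = 3 from map_ofNat C 3]
    push_cast
    ring
  have e2 : ∑ j, X j * pderiv i (X j * P) = X i * P + (∑ j, X j ^ 2) * pderiv i P := by
    simp only [Derivation.leibniz, smul_eq_mul, mul_add, Finset.sum_add_distrib, pderiv_X]
    rw [add_comm, Finset.sum_mul]
    congr 1
    · simp [Pi.single_apply]
    · exact Finset.sum_congr rfl fun j _ => by ring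
  rw [e1, e2, map_add, sphInt_sum_sq_mul, map_smul, smul_eq_mul] at h
  linear_combination h

/-! ### The Laplacian and orthogonality of harmonic polynomials -/

theorem polyLaplacian_apply (P : MvPolynomial (Fin 3) ℝ) :
    polyLaplacian P = ∑ i, pderiv i (pderiv i P) := by
  simp [polyLaplacian]

/-- The commutator of two derivations is a derivation, and this one vanishes on the variables. -/
theorem pderiv_pderiv_comm (i j : Fin 3) (P : MvPolynomial (Fin 3) ℝ) :
    pderiv i (pderiv j P) = pderiv j (pderiv i P) := by
  let D : Fin 3 → Derivation ℝ (MvPolynomial (Fin 3) ℝ) (MvPolynomial (Fin 3) ℝ) :=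
    fun i => pderiv i
  have h : ⁅D i, D j⁆ = 0 := by
    refine MvPolynomial.derivation_ext fun k => ?_
    rw [Derivation.commutator_apply]
    simp only [D]
    rcases eq_or_ne k i with rfl | hi <;> rcases eq_or_ne k j with rfl | hj <;>
      simp [pderiv_X, *]
  have h2 := Derivation.congr_fun h P
  rwa [Derivation.commutator_apply, Derivation.zero_apply, sub_eq_zero] at h2

theorem polyLaplacian_pderiv (i : Fin 3) (P : MvPolynomial (Fin 3) ℝ) :
    polyLaplacian (pderiv i P) = pderiv i (polyLaplacian P) := by
  simp only [polyLaplacian_apply, map_sum]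
  refine Finset.sum_congr rfl fun j _ => ?_
  rw [pderiv_pderiv_comm j i, pderiv_pderiv_comm j i]

theorem pderiv_mem_harmonicPoly {k : ℕ} {P : MvPolynomial (Fin 3) ℝ} (hP : P ∈ harmonicPoly (k + 1))
    (i : Fin 3) : pderiv i P ∈ harmonicPoly k := by
  obtain ⟨h1, h2⟩ := hP
  refine ⟨MvPolynomial.IsHomogeneous.pderiv h1, ?_⟩
  have h2 : polyLaplacian P = 0 := h2
  change polyLaplacian _ = 0
  rw [polyLaplacian_pderiv, h2, map_zero]

/-- Harmonic homogeneous polynomials are orthogonal on the sphere to homogeneous polynomials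
of smaller degree. -/
theorem sphInt_harmonic_mul_eq_zero {k j : ℕ} (hjk : j < k) {P S : MvPolynomial (Fin 3) ℝ}
    (hP : P ∈ harmonicPoly k) (hS : S.IsHomogeneous j) : sphInt (P * S) = 0 := by
  induction k generalizing j P S with
  | zero => omega
  | succ k ih =>
    have hPh : P.IsHomogeneous (k + 1) := hP.1
    have hE := hPh.sum_X_mul_pderiv
    -- Euler's relation writes P through its gradient; the divergence theorem then produces ΔP · S =
    -- 0 and products of first derivatives, to which the induction hypothesis applies since both
    -- degrees have dropped by one.
    have h1 : ((k + 1 : ℕ) : ℝ) * sphInt (P * S) = ∑ i, sphInt (X i * (pderiv i P * S)) := by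
      rw [← map_sum]
      simp only [← mul_assoc, ← Finset.sum_mul, hE]
      rw [smul_mul_assoc, map_nsmul, nsmul_eq_mul]
    have h2 : ∀ i, sphInt (pderiv i P * pderiv i S) = 0 := by
      intro i
      cases j with
      | zero =>
        have hS0 : S.totalDegree = 0 := Nat.le_zero.mp hS.totalDegree_le
        rw [totalDegree_eq_zero_iff_eq_C.mp hS0]
        simp
      | succ j => exact ih (by omega) (pderiv_mem_harmonicPoly hP i) hS.pderiv
    have h3 : ((k + j : ℕ) + 2 : ℝ) * ∑ i, sphInt (X i * (pderiv i P * S)) = 0 := by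
      rw [Finset.mul_sum]
      have : ∀ i, ((k + j : ℕ) + 2 : ℝ) * sphInt (X i * (pderiv i P * S)) =
          sphInt (pderiv i (pderiv i P) * S) := by
        intro i
        have hh : (pderiv i P * S).IsHomogeneous (k + j) := (hPh.pderiv (i := i)).mul hS
        rw [sphInt_X_mul hh, Derivation.leibniz, smul_eq_mul, smul_eq_mul,
          map_add, h2, zero_add, mul_comm]
      simp only [this]
      rw [← map_sum, ← Finset.sum_mul, ← polyLaplacian_apply, LinearMap.mem_ker.mp hP.2]
      simp
    rw [← h1] at h3
    have a1 : ((k + j : ℕ) + 2 : ℝ) ≠ 0 := by positivity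
    have a2 : ((k + 1 : ℕ) : ℝ) ≠ 0 := by positivity
    exact (mul_eq_zero.mp ((mul_eq_zero.mp h3).resolve_left a1)).resolve_left a2

/-! ### Decomposition of homogeneous polynomials into harmonic ones -/

/-- The polynomial `|x|²`. -/
noncomputable def normSqPoly : MvPolynomial (Fin 3) ℝ := ∑ i, X i ^ 2

theorem isHomogeneous_normSqPoly : normSqPoly.IsHomogeneous 2 :=
  IsHomogeneous.sum _ _ _ fun i _ => isHomogeneous_X_pow i 2

theorem isHomogeneous_polyLaplacian {P : MvPolynomial (Fin 3) ℝ} {k : ℕ} (hP : P.IsHomogeneous k) :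
    (polyLaplacian P).IsHomogeneous (k - 2) := by
  rw [polyLaplacian_apply]
  exact IsHomogeneous.sum _ _ _ fun i _ => hP.pderiv.pderiv

theorem polyLaplacian_eq_zero {P : MvPolynomial (Fin 3) ℝ} {k : ℕ} (hP : P.IsHomogeneous k)
    (hk : k < 2) : polyLaplacian P = 0 := by
  rw [polyLaplacian_apply]
  refine Finset.sum_eq_zero fun i _ => ?_
  have h : (pderiv i P).totalDegree = 0 := by
    have := (hP.pderiv (i := i)).totalDegree_le
    omega
  rw [totalDegree_eq_zero_iff_eq_C.mp h, pderiv_C]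

theorem polyLaplacian_normSqPoly_mul {P : MvPolynomial (Fin 3) ℝ} {k : ℕ} (hP : P.IsHomogeneous k) :
    polyLaplacian (normSqPoly * P) = (4 * k + 6 : ℝ) • P + normSqPoly * polyLaplacian P := by
  have hd : ∀ i : Fin 3, pderiv i normSqPoly = 2 * X i := by
    intro i
    simp only [normSqPoly, map_sum, pderiv_pow, pderiv_X]
    simp [Pi.single_apply]
  have hE := hP.sum_X_mul_pderiv
  have h : ∀ i : Fin 3, pderiv i (pderiv i (normSqPoly * P)) =
      2 * P + 4 * (X i * pderiv i P) + normSqPoly * pderiv i (pderiv i P) := by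
    intro i
    have h2 : pderiv i (2 : MvPolynomial (Fin 3) ℝ) = 0 := by
      rw [← map_ofNat C 2, pderiv_C]
    simp only [pderiv_mul, map_add, hd, h2, pderiv_X_self]
    ring
  rw [polyLaplacian_apply, polyLaplacian_apply]
  simp only [h, Finset.sum_add_distrib, ← Finset.mul_sum, hE]
  simp only [Finset.sum_const, Finset.card_univ, Fintype.card_fin, nsmul_eq_mul, smul_eq_C_mul,
      map_add, map_natCast, map_mul, map_ofNat]
  push_cast
  ring

/-- Solvability of `c Q + |x|² ΔQ = S` in homogeneous polynomials for `c > 0`. -/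
theorem exists_smul_add_normSqPoly_mul_laplacian (k : ℕ) : ∀ (c : ℝ), 0 < c →
    ∀ S : MvPolynomial (Fin 3) ℝ, S.IsHomogeneous k →
    ∃ P : MvPolynomial (Fin 3) ℝ, P.IsHomogeneous k ∧ c • P + normSqPoly * polyLaplacian P = S := by
  induction k using Nat.strong_induction_on with
  | _ k ih =>
    intro c hc S hS
    by_cases hk : k < 2
    · refine ⟨c⁻¹ • S, ?_, ?_⟩
      · exact (homogeneousSubmodule (Fin 3) ℝ k).smul_mem _ hS
      · rw [map_smul, polyLaplacian_eq_zero hS hk, smul_smul, mul_inv_cancel₀ hc.ne']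
        simp
    · obtain ⟨U, hU, hUS⟩ := ih (k - 2) (by omega) (c + (4 * (k - 2 : ℕ) + 6)) (by positivity)
        _ (isHomogeneous_polyLaplacian hS)
      have hk2 : 2 + (k - 2) = k := by omega
      have hmul : (normSqPoly * U).IsHomogeneous k := hk2 ▸ isHomogeneous_normSqPoly.mul hU
      have hlap := polyLaplacian_normSqPoly_mul hU
      have hL : polyLaplacian (c⁻¹ • (S - normSqPoly * U)) = U := by
        rw [map_smul, map_sub, hlap, ← hUS, add_smul, inv_smul_eq_iff₀ hc.ne']
        abel
      refine ⟨c⁻¹ • (S - normSqPoly * U), ?_, ?_⟩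
      · exact (homogeneousSubmodule (Fin 3) ℝ k).smul_mem _
          ((homogeneousSubmodule (Fin 3) ℝ k).sub_mem hS hmul)
      · rw [hL, smul_smul, mul_inv_cancel₀ hc.ne', one_smul, sub_add_cancel]

/-- P - |x|²S is harmonic exactly when (4k+6)S + |x|²ΔS = ΔP, which has just been shown solvable. -/
theorem exists_harmonic_add_normSqPoly_mul {P : MvPolynomial (Fin 3) ℝ} {k : ℕ}
    (hP : P.IsHomogeneous (k + 2)) : ∃ H ∈ harmonicPoly (k + 2),
      ∃ S : MvPolynomial (Fin 3) ℝ, S.IsHomogeneous k ∧ P = H + normSqPoly * S := by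
  obtain ⟨S, hS, hSP⟩ := exists_smul_add_normSqPoly_mul_laplacian k (4 * k + 6) (by positivity)
    _ (isHomogeneous_polyLaplacian hP)
  have hmul : (normSqPoly * S).IsHomogeneous (k + 2) :=
    add_comm 2 k ▸ isHomogeneous_normSqPoly.mul hS
  refine ⟨P - normSqPoly * S, ⟨?_, ?_⟩, S, hS, by ring⟩
  · exact (homogeneousSubmodule (Fin 3) ℝ _).sub_mem hP hmul
  · change polyLaplacian _ = 0
    rw [map_sub, polyLaplacian_normSqPoly_mul hS, hSP, sub_self]

/-! ### Polynomial functions on the sphere: spanning sets, dimension, rotations -/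

/-- Restrictions to the sphere of the harmonic homogeneous polynomials of degree `m`. -/
noncomputable def harmonicFun (m : ℕ) : Submodule ℝ C(S2, ℝ) :=
  (harmonicPoly m).map restrictPoly.toLinearMap

/-- Restrictions to the sphere of the polynomials of degree at most `N`. -/
noncomputable def polyFun (N : ℕ) : Submodule ℝ C(S2, ℝ) :=
  (restrictTotalDegree (Fin 3) ℝ N).map restrictPoly.toLinearMap

instance (N : ℕ) : FiniteDimensional ℝ (polyFun N) := by
  unfold polyFun; infer_instance

theorem harmonicFun_le_polyFun {m N : ℕ} (h : m ≤ N) : harmonicFun m ≤ polyFun N := by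
  refine Submodule.map_mono fun P hP => ?_
  rw [mem_restrictTotalDegree]
  exact (IsHomogeneous.totalDegree_le hP.1).trans h

theorem restrictPoly_homogeneous_mem (k : ℕ) : ∀ P : MvPolynomial (Fin 3) ℝ, P.IsHomogeneous k →
    restrictPoly P ∈ ⨆ m ∈ Finset.range (k + 1), harmonicFun m := by
  induction k using Nat.strong_induction_on with
  | _ k ih =>
    intro P hP
    have hle : ∀ m ∈ Finset.range (k + 1), harmonicFun m ≤ ⨆ m ∈ Finset.range (k + 1), harmonicFun m :=
      fun m hm => le_biSup harmonicFun hm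
    by_cases hk : k < 2
    · exact hle k (by simp) ⟨P, ⟨hP, polyLaplacian_eq_zero hP hk⟩, rfl⟩
    · obtain ⟨k, rfl⟩ : ∃ j, k = j + 2 := ⟨k - 2, by omega⟩
      obtain ⟨H, hH, S, hS, rfl⟩ := exists_harmonic_add_normSqPoly_mul hP
      rw [map_add, map_mul, normSqPoly, restrictPoly_sum_sq, one_mul]
      refine Submodule.add_mem _ (hle (k + 2) (by simp) ⟨H, hH, rfl⟩) ?_
      have hmono : ⨆ m ∈ Finset.range (k + 1), harmonicFun m ≤
          ⨆ m ∈ Finset.range (k + 2 + 1), harmonicFun m := biSup_mono fun m hm => by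
        simp only [Finset.mem_range] at hm ⊢
        omega
      exact hmono (ih k (by omega) S hS)

theorem polyFun_le_iSup (N : ℕ) : polyFun N ≤ ⨆ m ∈ Finset.range (N + 1), harmonicFun m := by
  rintro _ ⟨P, hP, rfl⟩
  have hP : P.totalDegree ≤ N := (mem_restrictTotalDegree _ _ _).mp hP
  change restrictPoly P ∈ _
  rw [← sum_homogeneousComponent P, map_sum]
  refine Submodule.sum_mem _ fun i hi => ?_
  have hmono : ⨆ m ∈ Finset.range (i + 1), harmonicFun m ≤
      ⨆ m ∈ Finset.range (N + 1), harmonicFun m := biSup_mono fun m hm => by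
    simp only [Finset.mem_range] at hm hi ⊢
    omega
  exact hmono (restrictPoly_homogeneous_mem i _ (homogeneousComponent_isHomogeneous i P))

/-- A spanning family of the polynomial functions of degree at most `N`: the monomials of degree
at most one in the last variable. -/
noncomputable def polyFunGen (p : ℕ × ℕ) : C(S2, ℝ) :=
  if p.2 ≤ p.1 then restrictPoly (X 0 ^ p.2 * X 1 ^ (p.1 - p.2))
  else restrictPoly (X 0 ^ p.1 * X 1 ^ (p.2 - p.1 - 1) * X 2)

theorem restrictPoly_monomial_mem_span (N c : ℕ) : ∀ a b : ℕ, a + b + c ≤ N →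
    restrictPoly (X 0 ^ a * X 1 ^ b * X 2 ^ c) ∈ Submodule.span ℝ
      (polyFunGen '' (Finset.range (N + 1) ×ˢ Finset.range (N + 1) : Finset (ℕ × ℕ))) := by
  induction c using Nat.strong_induction_on with
  | _ c ih =>
    intro a b h
    match c with
    | 0 =>
      refine Submodule.subset_span ⟨(a + b, a), ?_, ?_⟩
      · simp; omega
      · simp [polyFunGen]
    | 1 =>
      refine Submodule.subset_span ⟨(a, a + b + 1), ?_, ?_⟩
      · simp; omega
      · have h1 : ¬ (a + b + 1 ≤ a) := by omega
        have h2 : a + b + 1 - a - 1 = b := by omega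
        simp [polyFunGen, h1, h2]
    | c + 2 =>
      -- On the sphere X₂² = 1 - X₀² - X₁² lowers the exponent of the last variable without raising
      -- the degree.
      have e : restrictPoly (X 0 ^ a * X 1 ^ b * X 2 ^ (c + 2)) =
          restrictPoly (X 0 ^ a * X 1 ^ b * X 2 ^ c)
          - restrictPoly (X 0 ^ (a + 2) * X 1 ^ b * X 2 ^ c)
          - restrictPoly (X 0 ^ a * X 1 ^ (b + 2) * X 2 ^ c) := by
        have hs := restrictPoly_sum_sq
        simp only [Fin.sum_univ_three, map_add, map_pow] at hs
        simp only [map_mul, map_pow]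
        linear_combination (restrictPoly (X 0) ^ a * restrictPoly (X 1) ^ b *
          restrictPoly (X 2) ^ c) * hs
      rw [e]
      exact Submodule.sub_mem _ (Submodule.sub_mem _ (ih c (by omega) _ _ (by omega))
        (ih c (by omega) _ _ (by omega))) (ih c (by omega) _ _ (by omega))

theorem polyFun_le_span (N : ℕ) : polyFun N ≤ Submodule.span ℝ
    (polyFunGen '' (Finset.range (N + 1) ×ˢ Finset.range (N + 1) : Finset (ℕ × ℕ))) := by
  rintro _ ⟨P, hP, rfl⟩
  have hP : P.totalDegree ≤ N := (mem_restrictTotalDegree _ _ _).mp hP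
  change restrictPoly P ∈ _
  rw [P.as_sum, map_sum]
  refine Submodule.sum_mem _ fun d hd => ?_
  have hdeg : d 0 + d 1 + d 2 ≤ N := by
    have := (le_totalDegree hd).trans hP
    rwa [Finsupp.sum_fintype _ _ (fun _ => rfl), Fin.sum_univ_three] at this
  have hmon : monomial d (P.coeff d) = P.coeff d • (X 0 ^ d 0 * X 1 ^ d 1 * X 2 ^ d 2 :
      MvPolynomial (Fin 3) ℝ) := by
    rw [monomial_eq, Finsupp.prod_fintype _ _ (by simp), Fin.prod_univ_three, smul_eq_C_mul]
  rw [hmon, map_smul]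
  exact Submodule.smul_mem _ _ (restrictPoly_monomial_mem_span N _ _ _ hdeg)

/-- The generators are indexed by a square of side N + 1: pairs on or below the diagonal carry the
monomials free of X₂, pairs above it those linear in X₂. -/
theorem finrank_polyFun_le (N : ℕ) : Module.finrank ℝ (polyFun N) ≤ (N + 1) ^ 2 := by
  classical
  have h := polyFun_le_span N
  rw [← Finset.coe_image] at h
  refine (Submodule.finrank_mono h).trans ((finrank_span_finset_le_card _).trans
    (Finset.card_image_le.trans ?_))
  simp [sq]

/-- Substituting linear forms for the variables does not raise the degree. The invariance makes the
reproducing kernel constant on the diagonal. -/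
theorem polyFun_comp_sphereMap {N : ℕ} {u : C(S2, ℝ)} (hu : u ∈ polyFun N)
    (ρ : E3 ≃ₗᵢ[ℝ] E3) : u.comp ⟨sphereMap ρ, continuous_sphereMap ρ⟩ ∈ polyFun N := by
  obtain ⟨P, hP, rfl⟩ := hu
  have hP : P.totalDegree ≤ N := (mem_restrictTotalDegree _ _ _).mp hP
  let ℓ : Fin 3 → MvPolynomial (Fin 3) ℝ := fun i =>
    ∑ j, C ((ρ (EuclideanSpace.single j 1)) i) * X j
  have hℓ : ∀ i, (ℓ i).totalDegree ≤ 1 := fun i =>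
    IsHomogeneous.totalDegree_le (IsHomogeneous.sum _ _ _ fun j _ =>
      by simpa using (isHomogeneous_C _ _).mul (isHomogeneous_X ℝ j))
  refine ⟨aeval ℓ P, ?_, ?_⟩
  · change _ ∈ restrictTotalDegree _ _ _
    rw [mem_restrictTotalDegree]
    conv_lhs => rw [P.as_sum, map_sum]
    refine totalDegree_finsetSum_le fun d hd => ?_
    rw [aeval_monomial]
    refine (totalDegree_mul _ _).trans ?_
    have h1 : (d.prod fun i k => ℓ i ^ k).totalDegree ≤ d.sum fun _ k => k := by
      refine (totalDegree_finsetProd _ _).trans (Finset.sum_le_sum fun i _ => ?_)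
      refine (totalDegree_pow _ _).trans ?_
      simpa using Nat.mul_le_mul_left (d i) (hℓ i)
    have h2 := (le_totalDegree hd).trans hP
    simp only [algebraMap_eq, totalDegree_C, zero_add]
    exact h1.trans h2
  · ext x
    change restrictPoly (aeval ℓ P) x = restrictPoly P (sphereMap ρ x)
    rw [restrictPoly_apply, restrictPoly_apply, ← coe_aeval_eq_eval]
    refine (comp_aeval_apply (φ := (aeval fun k => (x : E3) k : MvPolynomial (Fin 3) ℝ →ₐ[ℝ] ℝ)) _ _).trans ?_
    have : ∀ i, eval (fun k => (x : E3) k) (ℓ i) = (ρ (x : E3)) i := by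
      intro i
      have hx : (x : E3) = ∑ j, (x : E3) j • EuclideanSpace.single j (1 : ℝ) := by
        ext k
        simp [Finset.sum_apply, Pi.single_apply]
      conv_rhs => rw [hx]
      simp [ℓ, mul_comm]
    have h2 : (fun i => aeval (fun k => (x : E3) k) (ℓ i)) = fun i => (ρ (x : E3)) i :=
      funext fun i => this i
    exact congrArg (fun v => aeval v P) h2

/-! ### The reproducing kernel bound for polynomial functions -/

/-- The embedding of continuous functions on the sphere into `L²(S²)`. -/
noncomputable def toL2 : C(S2, ℝ) →L[ℝ] L2 := ContinuousMap.toLp (E := ℝ) 2 surf ℝ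

theorem toL2_injective : Function.Injective toL2 := ContinuousMap.toLp_injective surf

theorem coeFn_toL2 (u : C(S2, ℝ)) : toL2 u =ᵐ[surf] u := ContinuousMap.coeFn_toLp surf u

theorem inner_toL2_left (u : C(S2, ℝ)) (f : L2) : inner ℝ (toL2 u) f = ∫ x, u x * f x ∂surf := by
  rw [L2.inner_def]
  refine integral_congr_ae ?_
  filter_upwards [coeFn_toL2 u] with x hx
  simp [hx, mul_comm]

theorem inner_toL2 (u v : C(S2, ℝ)) : inner ℝ (toL2 u) (toL2 v) = ∫ x, u x * v x ∂surf := by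
  rw [inner_toL2_left]
  refine integral_congr_ae ?_
  filter_upwards [coeFn_toL2 v] with x hx
  simp [hx]

theorem norm_toL2_sq (u : C(S2, ℝ)) : ‖toL2 u‖ ^ 2 = ∫ x, u x * u x ∂surf := by
  rw [← inner_toL2, real_inner_self_eq_norm_sq]

/-- The evaluation of polynomial functions of degree at most `N` at a point of the sphere is
bounded in terms of the `L²` norm, with the optimal constant. -/
theorem sq_apply_le_of_mem_polyFun {N : ℕ} {u : C(S2, ℝ)} (hu : u ∈ polyFun N) (x : S2) :
    u x ^ 2 ≤ ((N : ℝ) + 1) ^ 2 / (4 * Real.pi) * ‖toL2 u‖ ^ 2 := by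
  let V : Submodule ℝ L2 := (polyFun N).map toL2.toLinearMap
  let b := stdOrthonormalBasis ℝ V
  have hb : ∀ i, ∃ e ∈ polyFun N, toL2 e = b i := fun i => (b i).2
  choose e he heb using hb
  have hon : Orthonormal ℝ fun i => toL2 (e i) := by
    simp only [heb]
    exact b.orthonormal.comp_linearIsometry V.subtypeₗᵢ
  have hexp : ∀ v ∈ polyFun N, v = ∑ i, inner ℝ (toL2 (e i)) (toL2 v) • e i := by
    intro v hv
    apply toL2_injective
    have h := congrArg Subtype.val (b.sum_repr' ⟨toL2 v, v, hv, rfl⟩)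
    rw [map_sum]
    simp only [map_smul, heb]
    simpa using h.symm
  have hnorm : ∀ c : _ → ℝ, ‖toL2 (∑ i, c i • e i)‖ ^ 2 = ∑ i, c i ^ 2 := by
    intro c
    rw [← real_inner_self_eq_norm_sq, map_sum]
    simp only [map_smul]
    rw [hon.inner_sum]
    simp [sq]
  -- The diagonal of the reproducing kernel. It bounds point evaluation by Cauchy-Schwarz, is
  -- constant by rotation invariance, and its integral is the dimension.
  let k : S2 → ℝ := fun y => ∑ i, e i y ^ 2
  have hk0 : ∀ y, 0 ≤ k y := fun y => Finset.sum_nonneg fun i _ => sq_nonneg _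
  have hbound : ∀ v ∈ polyFun N, ∀ y, v y ^ 2 ≤ ‖toL2 v‖ ^ 2 * k y := by
    intro v hv y
    have h1 := hexp v hv
    have h2 := hnorm fun i => inner ℝ (toL2 (e i)) (toL2 v)
    rw [← h1] at h2
    rw [h2]
    conv_lhs => rw [h1]
    simp only [ContinuousMap.sum_apply, ContinuousMap.smul_apply, smul_eq_mul]
    exact Finset.sum_mul_sq_le_sq_mul_sq _ _ _
  have hinv : ∀ y ρ, k (sphereMap ρ y) ≤ k y := by
    intro y ρ
    -- The kernel function at ρy. After composition with ρ its value at y and its squared norm both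
    -- equal k(ρy), so `hbound` reads k(ρy)² ≤ k(ρy) k(y).
    let w : C(S2, ℝ) := ∑ i, e i (sphereMap ρ y) • e i
    have hw : w ∈ polyFun N := Submodule.sum_mem _ fun i _ => Submodule.smul_mem _ _ (he i)
    have h1 := hbound _ (polyFun_comp_sphereMap hw ρ) y
    have h2 : ‖toL2 (w.comp ⟨sphereMap ρ, continuous_sphereMap ρ⟩)‖ ^ 2 = k (sphereMap ρ y) := by
      have h3 : ‖toL2 w‖ ^ 2 = k (sphereMap ρ y) := hnorm _
      rw [← h3, norm_toL2_sq, norm_toL2_sq]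
      exact integral_comp_sphereMap ρ (w * w)
    have h4 : w.comp ⟨sphereMap ρ, continuous_sphereMap ρ⟩ y = k (sphereMap ρ y) := by
      simp [w, k, sq]
    rw [h2, h4] at h1
    rcases (hk0 (sphereMap ρ y)).eq_or_lt with h | h
    · rw [← h]; exact hk0 y
    · nlinarith
  have hconst : ∀ y, k x ≤ k y := fun y => by
    obtain ⟨ρ, rfl⟩ := exists_sphereMap_eq y x
    exact hinv y ρ
  have hint : ∫ y, k y ∂surf = Module.finrank ℝ V := by
    have h1 : ∀ i, Integrable (fun y => e i y ^ 2) surf := fun i => integrable_continuousMap (e i ^ 2)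
    simp only [k]
    rw [integral_finsetSum _ fun i _ => h1 i]
    have h2 : ∀ i, ∫ y, e i y ^ 2 ∂surf = 1 := by
      intro i
      have := norm_toL2_sq (e i)
      rw [hon.1 i] at this
      simp only [sq]
      linarith
    simp [h2]
  have hkx : 4 * Real.pi * k x ≤ ((N : ℝ) + 1) ^ 2 := by
    have h1 : ∫ _, k x ∂surf ≤ ∫ y, k y ∂surf := by
      refine integral_mono (integrable_const _) ?_ hconst
      exact integrable_finsetSum _ fun i _ => integrable_continuousMap (e i ^ 2)
    rw [hint, integral_const, surf_univ, smul_eq_mul] at h1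
    refine h1.trans ?_
    have h2 := (Submodule.finrank_map_le toL2.toLinearMap (polyFun N)).trans (finrank_polyFun_le N)
    exact_mod_cast h2
  refine (hbound u hu x).trans ?_
  rw [mul_comm]
  refine mul_le_mul_of_nonneg_right ?_ (sq_nonneg _)
  rw [le_div_iff₀ (by positivity)]
  linarith

/-! ### Orthogonality and completeness of the spherical harmonics -/

theorem sphHarm_eq_map (m : ℕ) : sphHarm m = (harmonicFun m).map toL2.toLinearMap := by
  rw [sphHarm, harmonicFun, ← Submodule.map_comp]
  rfl

theorem inner_sphHarm_eq_zero {m n : ℕ} (hmn : m ≠ n) {u v : L2} (hu : u ∈ sphHarm m)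
    (hv : v ∈ sphHarm n) : inner ℝ u v = 0 := by
  wlog h : n < m generalizing m n u v
  · rw [real_inner_comm]
    exact this hmn.symm hv hu (by omega)
  obtain ⟨P, hP, rfl⟩ := hu
  obtain ⟨S, hS, rfl⟩ := hv
  have := sphInt_harmonic_mul_eq_zero h hP hS.1
  rw [sphInt_apply, map_mul] at this
  exact (inner_toL2 _ _).trans this

theorem Q_mem (m : ℕ) (f : L2) : Q m f ∈ sphHarm m :=
  Submodule.starProjection_apply_mem _ f

theorem norm_Q_le (m : ℕ) (f : L2) : ‖Q m f‖ ≤ ‖f‖ := Submodule.norm_starProjection_apply_le _ f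

theorem inner_Q_left (m : ℕ) (f g : L2) : inner ℝ (Q m f) g = inner ℝ f (Q m g) :=
  Submodule.inner_starProjection_left_eq_right _ f g

theorem Q_of_mem {m : ℕ} {f : L2} (hf : f ∈ sphHarm m) : Q m f = f :=
  Submodule.starProjection_eq_self_iff.mpr hf

theorem inner_Q_Q {m n : ℕ} (hmn : m ≠ n) (f g : L2) : inner ℝ (Q m f) (Q n g) = 0 :=
  inner_sphHarm_eq_zero hmn (Q_mem m f) (Q_mem n g)

theorem Q_Q_self (m : ℕ) (f : L2) : Q m (Q m f) = Q m f := Q_of_mem (Q_mem m f)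

/-- The polynomials of degree at most `N`, as a subspace of `L²(S²)`. -/
noncomputable def polyL2 (N : ℕ) : Submodule ℝ L2 := (polyFun N).map toL2.toLinearMap

instance (N : ℕ) : FiniteDimensional ℝ (polyL2 N) := by
  unfold polyL2; infer_instance

theorem sphHarm_le_polyL2 {m N : ℕ} (h : m ≤ N) : sphHarm m ≤ polyL2 N := by
  rw [sphHarm_eq_map]
  exact Submodule.map_mono (harmonicFun_le_polyFun h)

theorem polyL2_le_iSup (N : ℕ) : polyL2 N ≤ ⨆ m ∈ Finset.range (N + 1), sphHarm m := by
  refine (Submodule.map_mono (polyFun_le_iSup N)).trans ?_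
  simp only [Submodule.map_iSup, sphHarm_eq_map, le_refl]

theorem starProjection_polyL2 (N : ℕ) (f : L2) :
    (polyL2 N).starProjection f = ∑ m ∈ Finset.range (N + 1), Q m f := by
  refine Submodule.eq_starProjection_of_mem_orthogonal ?_ ?_
  · exact Submodule.sum_mem _ fun m hm =>
      sphHarm_le_polyL2 (by simp at hm; omega) (Q_mem m f)
  · refine Submodule.orthogonal_le (polyL2_le_iSup N) ?_
    rw [← Submodule.iInf_orthogonal, Submodule.mem_iInf]
    intro n
    by_cases hn : n ∈ Finset.range (N + 1)
    swap
    · rw [iSup_neg hn, Submodule.bot_orthogonal_eq_top]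
      exact Submodule.mem_top
    rw [iSup_pos hn]
    rw [Submodule.mem_orthogonal]
    intro u hu
    rw [inner_sub_right, inner_sum, Finset.sum_eq_single_of_mem n hn]
    · rw [← inner_Q_left, Q_of_mem hu, sub_self]
    · exact fun m _ hmn => inner_sphHarm_eq_zero hmn.symm hu (Q_mem m f)

theorem monotone_polyL2 : Monotone polyL2 := fun M N h => by
  refine Submodule.map_mono (Submodule.map_mono fun P hP => ?_)
  rw [MvPolynomial.mem_restrictTotalDegree] at hP ⊢
  exact hP.trans h

/-- Stone-Weierstrass: the coordinates separate the points of the sphere, and continuous functions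
are dense in L². -/
theorem dense_polyL2 : ⊤ ≤ (⨆ N, polyL2 N).topologicalClosure := by
  have hsep : (restrictPoly.range).SeparatesPoints := by
    intro x y hxy
    obtain ⟨i, hi⟩ : ∃ i, (x : E3) i ≠ (y : E3) i := by
      by_contra! h
      exact hxy (Subtype.ext (by ext i; exact h i))
    refine ⟨_, ⟨restrictPoly (MvPolynomial.X i), ⟨_, rfl⟩, rfl⟩, ?_⟩
    simpa [restrictPoly_apply] using hi
  have h1 := ContinuousMap.subalgebra_topologicalClosure_eq_top_of_separatesPoints _ hsep
  have h2 : Dense (restrictPoly.range : Set C(S2, ℝ)) := by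
    rw [dense_iff_closure_eq, ← Subalgebra.topologicalClosure_coe, h1]
    rfl
  have h3 : DenseRange toL2 := ContinuousMap.toLp_denseRange ℝ surf ℝ (by simp)
  have h4 := h3.dense_image toL2.continuous h2
  intro f _
  refine closure_mono ?_ (h4 f)
  rintro _ ⟨_, ⟨P, rfl⟩, rfl⟩
  refine Submodule.mem_iSup_of_mem P.totalDegree ?_
  exact ⟨_, ⟨P, (MvPolynomial.mem_restrictTotalDegree _ _ _).mpr le_rfl, rfl⟩, rfl⟩

theorem tendsto_sum_Q (f : L2) :
    Filter.Tendsto (fun N => ∑ m ∈ Finset.range (N + 1), Q m f) Filter.atTop (nhds f) := by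
  simp only [← starProjection_polyL2]
  exact Submodule.starProjection_tendsto_self _ monotone_polyL2 f dense_polyL2

/-! ### The operator T in the harmonic expansion -/

theorem coeff_pos {R : ℝ} (hR : 1 < R) (m : ℕ) : 0 < coeff R m := by
  unfold coeff; positivity

/-- A ratio slightly above 1/R absorbs the quadratic factor; B is the sum of the convergent series
of the quotients, up to dropping R³ ≥ 1. -/
theorem coeff_le_geometric {R r : ℝ} (hR : 1 < R) (hr : R⁻¹ < r) :
    ∃ B > 0, ∀ m, coeff R m ≤ B * r ^ m := by
  have hR0 : 0 < R := by linarith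
  have hr0 : 0 < r := (inv_pos.mpr hR0).trans hr
  set q := R⁻¹ / r
  have hq0 : 0 < q := by positivity
  have hq1 : ‖q‖ < 1 := by
    rw [Real.norm_of_nonneg hq0.le]
    exact (div_lt_one hr0).mpr hr
  have hs : Summable fun m : ℕ => ((m : ℝ) + 1) * ((m : ℝ) + 2) * q ^ m := by
    refine (((summable_pow_mul_geometric_of_norm_lt_one 2 hq1).add
      ((summable_pow_mul_geometric_of_norm_lt_one 1 hq1).mul_left 3)).add
      ((summable_pow_mul_geometric_of_norm_lt_one 0 hq1).mul_left 2)).congr fun m => ?_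
    ring
  refine ⟨∑' m : ℕ, ((m : ℝ) + 1) * ((m : ℝ) + 2) * q ^ m,
    hs.tsum_pos (fun m => by positivity) 0 (by norm_num), fun m => ?_⟩
  have h1 := hs.le_tsum m fun j _ => by positivity
  refine le_trans ?_ (mul_le_mul_of_nonneg_right h1 (by positivity))
  have h2 : q ^ m * r ^ m = 1 / R ^ m := by
    rw [← mul_pow, div_mul_cancel₀ _ hr0.ne', inv_pow, one_div]
  rw [mul_assoc, h2, coeff, pow_add, mul_one_div]
  gcongr
  exact le_mul_of_one_le_right (by positivity) (one_le_pow₀ hR.le)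

theorem hasSum_T {R : ℝ} (hR : 1 < R) (f : L2) : HasSum (fun m => coeff R m • Q m f) (T R f) :=
  (summable_T hR f).hasSum

theorem T_sub {R : ℝ} (hR : 1 < R) (f g : L2) : T R (f - g) = T R f - T R g := by
  refine (hasSum_T hR (f - g)).unique ?_
  simpa only [map_sub, smul_sub] using (hasSum_T hR f).sub (hasSum_T hR g)

theorem Q_Q_of_ne {m n : ℕ} (h : m ≠ n) (f : L2) : Q m (Q n f) = 0 := by
  rw [← inner_self_eq_zero (𝕜 := ℝ), inner_Q_left, Q_Q_self, real_inner_comm]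
  exact inner_Q_Q h _ _

theorem Q_T {R : ℝ} (hR : 1 < R) (m : ℕ) (f : L2) : Q m (T R f) = coeff R m • Q m f := by
  have h := (hasSum_T hR f).mapL (Q m)
  refine h.unique ?_
  have h2 := hasSum_single (f := fun n => Q m (coeff R n • Q n f)) m fun n hn => by
    rw [map_smul, Q_Q_of_ne hn.symm, smul_zero]
  simpa only [map_smul, Q_Q_self] using h2

theorem inner_Q_T {R : ℝ} (hR : 1 < R) (m : ℕ) (f h : L2) :
    inner ℝ (Q m f) (T R h) = coeff R m * inner ℝ (Q m f) h := by
  rw [← Q_Q_self, inner_Q_left, Q_T hR, inner_smul_right, ← inner_Q_left, Q_Q_self]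

theorem norm_T_sub_sum_le {R : ℝ} (hR : 1 < R) {B r : ℝ} (hr : r < 1)
    (hB : ∀ m, coeff R m ≤ B * r ^ m) (f : L2) (N : ℕ) :
    ‖T R f - ∑ m ∈ Finset.range N, Q m (T R f)‖ ≤ B * ‖f‖ * r ^ N / (1 - r) := by
  simp only [Q_T hR]
  rw [norm_sub_rev]
  refine norm_sub_le_of_geometric_bound_of_hasSum hr (fun m => ?_) (hasSum_T hR f) N
  rw [norm_smul, Real.norm_of_nonneg (coeff_pos hR m).le]
  calc coeff R m * ‖Q m f‖ ≤ (B * r ^ m) * ‖f‖ :=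
        mul_le_mul (hB m) (norm_Q_le m f) (norm_nonneg _) ((coeff_pos hR m).le.trans (hB m))
    _ = B * ‖f‖ * r ^ m := by ring

/-! ### Estimates in L¹ and the Sobolev tail -/

theorem integrable_coe (f : L2) : Integrable f surf := (Lp.memLp f).integrable one_le_two

theorem integral_abs_le (f : L2) : ∫ x, |f x| ∂surf ≤ √(4 * Real.pi) * ‖f‖ := by
  have h1 : ∫ x, |f x| ∂surf = inner ℝ (toL2 1) |f| := by
    rw [inner_toL2_left]
    refine integral_congr_ae ?_
    filter_upwards [Lp.coeFn_abs f] with x hx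
    simp [hx]
  have h2 : ‖toL2 1‖ = √(4 * Real.pi) := by
    rw [← Real.sqrt_sq (norm_nonneg (toL2 1)), norm_toL2_sq]
    simp [surf_univ]
  rw [h1, ← h2, ← norm_abs_eq_norm f]
  exact real_inner_le_norm _ _

theorem abs_inner_toL2_le {v : C(S2, ℝ)} {M : ℝ} (hv : ∀ x, |v x| ≤ M) (f : L2) :
    |inner ℝ (toL2 v) f| ≤ M * ∫ x, |f x| ∂surf := by
  rw [inner_toL2_left, ← integral_const_mul]
  refine (abs_integral_le_integral_abs).trans ?_
  refine integral_mono_of_nonneg (Filter.Eventually.of_forall fun x => abs_nonneg _)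
    ((integrable_coe f).abs.const_mul M) (Filter.Eventually.of_forall fun x => ?_)
  simp only [abs_mul]
  exact mul_le_mul_of_nonneg_right (hv x) (abs_nonneg _)

theorem abs_apply_le_of_mem_polyFun {N : ℕ} {u : C(S2, ℝ)} (hu : u ∈ polyFun N) (x : S2) :
    |u x| ≤ ((N : ℝ) + 1) / √(4 * Real.pi) * ‖toL2 u‖ := by
  refine abs_le_of_sq_le_sq ?_ (by positivity)
  rw [mul_pow, div_pow, Real.sq_sqrt (by positivity)]
  exact sq_apply_le_of_mem_polyFun hu x

/-- The projection onto the polynomials of degree at most `N` maps `L¹` into `L^∞`. -/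
theorem abs_apply_le_of_eq_sum_Q {N : ℕ} {v : C(S2, ℝ)} (hv : v ∈ polyFun N) {g : L2}
    (hvg : toL2 v = ∑ m ∈ Finset.range (N + 1), Q m g) (x : S2) :
    |v x| ≤ ((N : ℝ) + 1) ^ 2 / (4 * Real.pi) * ∫ x, |g x| ∂surf := by
  set a := ‖toL2 v‖
  set s := ((N : ℝ) + 1) / √(4 * Real.pi)
  set t := ∫ x, |g x| ∂surf
  have ht : 0 ≤ t := integral_nonneg fun x => abs_nonneg _
  have hs : 0 ≤ s := by positivity
  have h1 : ∀ x, |v x| ≤ s * a := abs_apply_le_of_mem_polyFun hv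
  have h2 : a ^ 2 = inner ℝ (toL2 v) g := by
    rw [← real_inner_self_eq_norm_sq, hvg, ← starProjection_polyL2,
      Submodule.inner_starProjection_left_eq_right, Submodule.starProjection_eq_self_iff.mpr
        (Submodule.starProjection_apply_mem _ g), Submodule.inner_starProjection_left_eq_right]
  -- The bound from L² to L^∞ is used twice, here by duality from L¹ to L²; hence the constant s².
  have h3 : a ^ 2 ≤ s * a * t := h2 ▸ (le_abs_self _).trans (abs_inner_toL2_le h1 g)
  have h4 : a ≤ s * t := by
    rcases (norm_nonneg (toL2 v)).eq_or_lt with h | h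
    · exact (le_of_eq h.symm).trans (mul_nonneg hs ht)
    · exact le_of_mul_le_mul_left (by linarith : a * a ≤ a * (s * t)) h
  have h5 : s ^ 2 = ((N : ℝ) + 1) ^ 2 / (4 * Real.pi) := by
    rw [div_pow, Real.sq_sqrt (by positivity)]
  rw [← h5]
  calc |v x| ≤ s * a := h1 x
    _ ≤ s * (s * t) := mul_le_mul_of_nonneg_left h4 hs
    _ = s ^ 2 * t := by ring

/-- The projection of g is bounded pointwise by its L¹ norm, so its integral over P gains the factor
|P|; the remainder is integrated over the whole sphere. -/
theorem setIntegral_abs_le (P : Set S2) (g : L2) (N : ℕ) :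
    ∫ x in P, |g x| ∂surf ≤
      surf.real P * (((N : ℝ) + 1) ^ 2 / (4 * Real.pi)) * (∫ x, |g x| ∂surf)
        + √(4 * Real.pi) * ‖g - ∑ m ∈ Finset.range (N + 1), Q m g‖ := by
  obtain ⟨v, hv, hvg⟩ : ∃ v ∈ polyFun N, toL2 v = ∑ m ∈ Finset.range (N + 1), Q m g := by
    rw [← starProjection_polyL2]
    exact Submodule.starProjection_apply_mem (polyL2 N) g
  have hb := abs_apply_le_of_eq_sum_Q hv hvg
  set t := ∫ x, |g x| ∂surf
  set w := g - ∑ m ∈ Finset.range (N + 1), Q m g with hw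
  have h1 : ∀ᵐ x ∂surf, |g x| ≤ ((N : ℝ) + 1) ^ 2 / (4 * Real.pi) * t + |w x| := by
    have : w = g - toL2 v := by rw [hw, hvg]
    filter_upwards [Lp.coeFn_sub g (toL2 v), coeFn_toL2 v] with x h1 h2
    rw [this, h1, Pi.sub_apply, h2]
    have h3 := hb x
    have h4 := abs_add_le (v x) (g x - v x)
    rw [add_sub_cancel] at h4
    linarith
  have hwi := (integrable_coe w).abs
  have hsum : Integrable (fun x => ((N : ℝ) + 1) ^ 2 / (4 * Real.pi) * t + |w x|) surf :=
    (integrable_const _).add hwi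
  calc ∫ x in P, |g x| ∂surf
      ≤ ∫ x in P, (((N : ℝ) + 1) ^ 2 / (4 * Real.pi) * t + |w x|) ∂surf :=
        integral_mono_ae (integrable_coe g).abs.integrableOn
          hsum.integrableOn (ae_restrict_of_ae h1)
    _ = surf.real P * (((N : ℝ) + 1) ^ 2 / (4 * Real.pi) * t) + ∫ x in P, |w x| ∂surf := by
        rw [integral_add (integrable_const _) hwi.integrableOn]
        simp
    _ ≤ surf.real P * (((N : ℝ) + 1) ^ 2 / (4 * Real.pi) * t) + √(4 * Real.pi) * ‖w‖ := by
        gcongr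
        exact (setIntegral_le_integral hwi (Filter.Eventually.of_forall fun x => abs_nonneg _)).trans
          (integral_abs_le w)
    _ = _ := by ring

/-- T acts on degree m as a scalar, so h can be replaced by Th at the cost of 1/`coeff R m`. The
factor m + 1 lost in the sup norm of Q m f cancels against the singular value. -/
theorem abs_inner_Q_le {R : ℝ} (hR : 1 < R) (m : ℕ) (f h : L2) :
    |inner ℝ (Q m f) h| ≤ R ^ (m + 3) * ‖f‖ * ∫ x, |T R h x| ∂surf := by
  have hR0 : 0 < R := by linarith
  have hmem : Q m f ∈ (harmonicFun m).map toL2.toLinearMap := sphHarm_eq_map m ▸ Q_mem m f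
  obtain ⟨v, hv, hvf⟩ := hmem
  have hvf : toL2 v = Q m f := hvf
  have h1 : ∀ x, |v x| ≤ ((m : ℝ) + 1) * ‖f‖ := by
    intro x
    refine (abs_apply_le_of_mem_polyFun (harmonicFun_le_polyFun le_rfl hv) x).trans ?_
    rw [hvf]
    refine mul_le_mul ?_ (norm_Q_le m f) (norm_nonneg _) (by positivity)
    refine div_le_self (by positivity) ?_
    rw [Real.one_le_sqrt]
    linarith [Real.pi_gt_three]
  have h2 := abs_inner_toL2_le h1 (T R h)
  rw [hvf, inner_Q_T hR, abs_mul, abs_of_pos (coeff_pos hR m), coeff, div_mul_eq_mul_div,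
    div_le_iff₀ (by positivity)] at h2
  set t := ∫ x, |T R h x| ∂surf
  have ht : 0 ≤ t := integral_nonneg fun x => abs_nonneg _
  have h3 : ((m : ℝ) + 1) * |inner ℝ (Q m f) h| ≤ ((m : ℝ) + 1) * (R ^ (m + 3) * ‖f‖ * t) := by
    calc ((m : ℝ) + 1) * |inner ℝ (Q m f) h|
        ≤ ((m : ℝ) + 1) * ((m : ℝ) + 2) * |inner ℝ (Q m f) h| := by
          refine mul_le_mul_of_nonneg_right ?_ (abs_nonneg _)
          exact le_mul_of_one_le_right (by positivity) (by linarith [(Nat.cast_nonneg m : (0 : ℝ) ≤ m)])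
      _ ≤ _ := h2.trans (le_of_eq (by ring))
  exact le_of_mul_le_mul_left h3 (by positivity)

theorem abs_inner_sum_Q_le {R : ℝ} (hR : 1 < R) (M : ℕ) (f h : L2) :
    |inner ℝ (∑ m ∈ Finset.range (M + 1), Q m f) h| ≤
      R ^ (M + 4) / (R - 1) * ‖f‖ * ∫ x, |T R h x| ∂surf := by
  have ht : 0 ≤ ∫ x, |T R h x| ∂surf := integral_nonneg fun x => abs_nonneg _
  rw [sum_inner]
  refine (Finset.abs_sum_le_sum_abs _ _).trans
    ((Finset.sum_le_sum fun m _ => abs_inner_Q_le hR m f h).trans ?_)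
  rw [← Finset.sum_mul, ← Finset.sum_mul]
  gcongr
  rw [Finset.sum_congr rfl fun m _ => pow_add R m 3]
  rw [← Finset.sum_mul, geom_sum_eq hR.ne', div_mul_eq_mul_div]
  have : 0 < R - 1 := by linarith
  gcongr
  rw [show R ^ (M + 4) = R ^ (M + 1) * R ^ 3 by ring]
  gcongr
  linarith

theorem norm_sum_Q_sq (s : Finset ℕ) (f : L2) :
    ‖∑ m ∈ s, Q m f‖ ^ 2 = ∑ m ∈ s, ‖Q m f‖ ^ 2 := by
  rw [← real_inner_self_eq_norm_sq, sum_inner]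
  refine Finset.sum_congr rfl fun m hm => ?_
  rw [inner_sum, Finset.sum_eq_single_of_mem m hm fun n _ hn => inner_Q_Q hn.symm f f,
    real_inner_self_eq_norm_sq]

theorem norm_sub_sum_Q_le {p : ℝ} (hp : 0 < p) {f : L2} (hf : MemSobolev p f) (M : ℕ) :
    ‖f - ∑ m ∈ Finset.range (M + 1), Q m f‖ ≤
      √(∑' m : ℕ, (1 + (m : ℝ) * ((m : ℝ) + 1)) ^ p * ‖Q m f‖ ^ 2) * ((M : ℝ) + 1) ^ (-p) := by
  set S := ∑' m : ℕ, (1 + (m : ℝ) * ((m : ℝ) + 1)) ^ p * ‖Q m f‖ ^ 2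
  have hM : (0 : ℝ) < (M : ℝ) + 1 := by positivity
  have hlim := (((tendsto_sum_Q f).sub_const (∑ m ∈ Finset.range (M + 1), Q m f)).norm).pow 2
  have hle : ‖f - ∑ m ∈ Finset.range (M + 1), Q m f‖ ^ 2 ≤ S * (((M : ℝ) + 1) ^ (-p)) ^ 2 := by
    refine le_of_tendsto hlim ?_
    filter_upwards [Filter.eventually_ge_atTop M] with N hN
    rw [← Finset.sum_Ico_eq_sub _ (by omega : M + 1 ≤ N + 1), norm_sum_Q_sq]
    have h1 : ∀ m ∈ Finset.Ico (M + 1) (N + 1), ‖Q m f‖ ^ 2 ≤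
        (1 + (m : ℝ) * ((m : ℝ) + 1)) ^ p * ‖Q m f‖ ^ 2 * (((M : ℝ) + 1) ^ (-p)) ^ 2 := by
      intro m hm
      have hm : (M : ℝ) + 1 ≤ m := by exact_mod_cast (Finset.mem_Ico.mp hm).1
      -- In the tail m ≥ M + 1, so the Sobolev weight is at least (M+1)^(2p).
      have h2 : (((M : ℝ) + 1) ^ 2) ^ p ≤ (1 + (m : ℝ) * ((m : ℝ) + 1)) ^ p :=
        Real.rpow_le_rpow (by positivity) (by nlinarith) hp.le
      have h3 : (((M : ℝ) + 1) ^ 2) ^ p * (((M : ℝ) + 1) ^ (-p)) ^ 2 = 1 := by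
        rw [← Real.rpow_natCast_mul hM.le, ← Real.rpow_mul_natCast hM.le, ← Real.rpow_add hM]
        rw [show ((2 : ℕ) : ℝ) * p + -p * ((2 : ℕ) : ℝ) = 0 by push_cast; ring, Real.rpow_zero]
      calc ‖Q m f‖ ^ 2 = (((M : ℝ) + 1) ^ 2) ^ p * (((M : ℝ) + 1) ^ (-p)) ^ 2 * ‖Q m f‖ ^ 2 := by
            rw [h3, one_mul]
        _ ≤ (1 + (m : ℝ) * ((m : ℝ) + 1)) ^ p * (((M : ℝ) + 1) ^ (-p)) ^ 2 * ‖Q m f‖ ^ 2 := by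
            gcongr
        _ = _ := by ring
    refine (Finset.sum_le_sum h1).trans ?_
    rw [← Finset.sum_mul]
    refine mul_le_mul_of_nonneg_right ?_ (sq_nonneg _)
    exact hf.sum_le_tsum _ fun m _ => by positivity
  have hS : 0 ≤ S := tsum_nonneg fun m => by positivity
  refine le_of_sq_le_sq ?_ (by positivity)
  rw [mul_pow, Real.sq_sqrt hS]
  exact hle

/-! ### Consequences of minimality -/

/-- The basic estimate that follows from minimality. -/
theorem tikhonov_basic_estimate {R α ε η : ℝ} (hR : 1 < R) (hα : 0 < α) (hη : 0 < η)
    {fdag fhat : L2} {ξ : S2 → ℝ} (hξ : Integrable ξ surf) (hn : ImpulsiveNoise ξ ε η)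
    (hmin : IsTikhonovMinimizer R α (fun x => T R fdag x + ξ x) fhat) :
    ∃ P : Set S2, MeasurableSet P ∧ surf.real P ≤ η ∧
      (∫ x, |T R (fhat - fdag) x| ∂surf) + α * (‖fhat - fdag‖ ^ 2 + 2 * inner ℝ fdag (fhat - fdag))
        ≤ 2 * ε + 2 * ∫ x in P, |T R (fhat - fdag) x| ∂surf := by
  obtain ⟨P, hP, hε, hPη⟩ := hn
  refine ⟨P, hP, ENNReal.toReal_le_of_le_ofReal hη.le hPη, ?_⟩
  have hm : tikhonov R α (fun x => T R fdag x + ξ x) fhat ≤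
    tikhonov R α (fun x => T R fdag x + ξ x) fdag := hmin (Set.mem_univ fdag)
  set h := fhat - fdag with hh
  have hT : T R h =ᵐ[surf] fun x => T R fhat x - T R fdag x := by
    rw [hh, T_sub hR]
    exact Lp.coeFn_sub _ _
  have e1 : ∫ x, |T R fhat x - (T R fdag x + ξ x)| ∂surf = ∫ x, |T R h x - ξ x| ∂surf := by
    refine integral_congr_ae ?_
    filter_upwards [hT] with x hx
    rw [hx, sub_sub]
  have e2 : ∫ x, |T R fdag x - (T R fdag x + ξ x)| ∂surf = ∫ x, |ξ x| ∂surf := by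
    simp
  have hnorm : ‖fhat‖ ^ 2 = ‖fdag‖ ^ 2 + 2 * inner ℝ fdag h + ‖h‖ ^ 2 := by
    rw [← norm_add_sq_real, hh, add_sub_cancel]
  simp only [tikhonov] at hm
  rw [e1, e2, hnorm, one_div, inv_mul_eq_div, inv_mul_eq_div] at hm
  have hm2 : (∫ x, |T R h x - ξ x| ∂surf) + α * (‖h‖ ^ 2 + 2 * inner ℝ fdag h) ≤
      ∫ x, |ξ x| ∂surf := by
    have := mul_le_mul_of_nonneg_left hm hα.le
    rw [mul_add, mul_div_cancel₀ _ hα.ne', mul_add α (_ / α), mul_div_cancel₀ _ hα.ne'] at this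
    linarith
  have hTi := (integrable_coe (T R h)).abs
  have hξi := hξ.abs
  have hdi := ((integrable_coe (T R h)).sub hξ).abs
  have s1 := integral_add_compl hP hTi
  have s2 := integral_add_compl hP hξi
  have s3 := integral_add_compl hP hdi
  -- The reverse triangle inequality is used with opposite signs on P and on its complement: on P
  -- the noise must cancel against ‖ξ‖₁, off P it is at most ε.
  have t1 : (∫ x in P, |ξ x| ∂surf) - ∫ x in P, |T R h x| ∂surf ≤
      ∫ x in P, |T R h x - ξ x| ∂surf := by
    rw [← integral_sub hξi.integrableOn hTi.integrableOn]
    refine integral_mono (hξi.sub hTi).integrableOn hdi.integrableOn fun x => ?_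
    have := abs_sub_abs_le_abs_sub (ξ x) (T R h x)
    rw [abs_sub_comm (T R h x)]
    exact this
  have t2 : (∫ x in Pᶜ, |T R h x| ∂surf) - ∫ x in Pᶜ, |ξ x| ∂surf ≤
      ∫ x in Pᶜ, |T R h x - ξ x| ∂surf := by
    rw [← integral_sub hTi.integrableOn hξi.integrableOn]
    exact integral_mono (hTi.sub hξi).integrableOn hdi.integrableOn fun x =>
      abs_sub_abs_le_abs_sub (T R h x) (ξ x)
  simp only [Pi.sub_apply] at s3
  linarith

/-! ### Exponentials against powers, and the two absorption estimates -/

theorem exists_rpow_le_exp (s : ℝ) {c : ℝ} (hc : 0 < c) :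
    ∃ K > 0, ∀ y, 0 ≤ y → 0 ≤ s → y ^ s ≤ K * Real.exp (c * y) := by
  set n := ⌈s⌉₊
  refine ⟨max 1 (n.factorial / c ^ n), by positivity, fun y hy hs => ?_⟩
  rcases le_total y 1 with h1 | h1
  · calc y ^ s ≤ 1 := Real.rpow_le_one hy h1 hs
      _ ≤ Real.exp (c * y) := Real.one_le_exp (by positivity)
      _ ≤ _ := le_mul_of_one_le_left (Real.exp_pos _).le (le_max_left _ _)
  · have h2 := Real.pow_div_factorial_le_exp (c * y) (by positivity) n
    calc y ^ s ≤ y ^ (n : ℝ) := Real.rpow_le_rpow_of_exponent_le h1 (Nat.le_ceil s)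
      _ = n.factorial / c ^ n * ((c * y) ^ n / n.factorial) := by
          rw [Real.rpow_natCast, mul_pow]
          field_simp
      _ ≤ _ := mul_le_mul (le_max_right _ _) h2 (by positivity) (by positivity)

/-- Any small share c of the exponent √(π/η) pays for any power of η. -/
theorem exists_rpow_sqrt_le {R c q : ℝ} (hR : 1 < R) (hc : 0 < c) (hq : 0 ≤ q) :
    ∃ K > 0, ∀ η, 0 < η → R ^ (-(c * √(Real.pi / η))) ≤ K * η ^ q := by
  have hR0 : 0 < R := by linarith
  obtain ⟨K, hK, h⟩ := exists_rpow_le_exp (2 * q) (mul_pos (Real.log_pos hR) hc)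
  refine ⟨K, hK, fun η hη => ?_⟩
  have hπη : 0 < Real.pi / η := by positivity
  have h1 := h √(Real.pi / η) (by positivity) (by positivity)
  rw [mul_assoc, ← Real.rpow_def_of_pos hR0, Real.rpow_mul (Real.sqrt_nonneg _), Real.rpow_two,
    Real.sq_sqrt hπη.le] at h1
  have h2 : (1 : ℝ) ≤ (Real.pi / η) ^ q * η ^ q := by
    rw [← Real.mul_rpow hπη.le hη.le, div_mul_cancel₀ _ hη.ne']
    exact Real.one_le_rpow (by linarith [Real.pi_gt_three]) hq
  rw [Real.rpow_neg hR0.le, inv_le_iff_one_le_mul₀ (by positivity)]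
  calc (1 : ℝ) ≤ (Real.pi / η) ^ q * η ^ q := h2
    _ ≤ (K * R ^ (c * √(Real.pi / η))) * η ^ q := by gcongr
    _ = _ := by ring

/-- The `L¹` norm of `T h` over a set of small measure. -/
theorem exists_setIntegral_T_le {R : ℝ} (hR : 1 < R) : ∃ C > 0, ∀ η, 0 < η → η ≤ 1 →
    ∀ P : Set S2, surf.real P ≤ η → ∀ h : L2,
      ∫ x in P, |T R h x| ∂surf ≤ 3 / 8 * (∫ x, |T R h x| ∂surf)
        + C * R ^ (-(11 / 10 * √(Real.pi / η))) * ‖h‖ := by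
  have hR0 : 0 < R := by linarith
  -- With N + 1 close to (6/5)√(π/η), the polynomial part costs (6/5)²/4 = 9/25 ≤ 3/8, and doubled
  -- still leaves room below 1. The tail exponent is (6/5)(19/20) = 57/50 ≥ 11/10; rounding in N
  -- costs the factor R.
  set r := R ^ (-(19 / 20) : ℝ) with hr
  have hr0 : 0 < r := by positivity
  have hr1 : r < 1 := Real.rpow_lt_one_of_one_lt_of_neg hR (by norm_num)
  have hrR : R⁻¹ < r := by
    rw [← Real.rpow_neg_one]
    exact Real.rpow_lt_rpow_of_exponent_lt hR (by norm_num)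
  obtain ⟨B, hB, hBc⟩ := coeff_le_geometric hR hrR
  have hr1' : 0 < 1 - r := by linarith
  refine ⟨√(4 * Real.pi) * (B * R / (1 - r)), by positivity, fun η hη hη1 P hP h => ?_⟩
  set x := √(Real.pi / η)
  have hx2 : x ^ 2 = Real.pi / η := Real.sq_sqrt (by positivity)
  have hx1 : 1 ≤ x := by
    rw [Real.one_le_sqrt, one_le_div hη]
    linarith [Real.pi_gt_three]
  obtain ⟨N, hN⟩ : ∃ N, ⌊6 / 5 * x⌋₊ = N + 1 := by
    refine Nat.exists_eq_succ_of_ne_zero (Nat.floor_pos.mpr ?_).ne'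
    linarith
  have hNle : (N : ℝ) + 1 ≤ 6 / 5 * x := by
    have := Nat.floor_le (by positivity : 0 ≤ 6 / 5 * x)
    rw [hN] at this
    exact_mod_cast this
  have hNge : 6 / 5 * x - 1 ≤ ((N + 1 : ℕ) : ℝ) := by
    rw [← hN]
    linarith [Nat.lt_floor_add_one (6 / 5 * x)]
  have h1 := setIntegral_abs_le P (T R h) N
  have h2 := norm_T_sub_sum_le hR hr1 hBc h (N + 1)
  have ht : 0 ≤ ∫ x, |T R h x| ∂surf := integral_nonneg fun x => abs_nonneg _
  have h3 : surf.real P * (((N : ℝ) + 1) ^ 2 / (4 * Real.pi)) ≤ 3 / 8 := by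
    have hsq : ((N : ℝ) + 1) ^ 2 ≤ 36 / 25 * (Real.pi / η) := by
      rw [← hx2]
      nlinarith [(Nat.cast_nonneg N : (0 : ℝ) ≤ N)]
    calc surf.real P * (((N : ℝ) + 1) ^ 2 / (4 * Real.pi))
        ≤ η * (36 / 25 * (Real.pi / η) / (4 * Real.pi)) := by gcongr
      _ = 9 / 25 := by field_simp; norm_num
      _ ≤ 3 / 8 := by norm_num
  have h4 : r ^ (N + 1) ≤ R * R ^ (-(11 / 10 * x)) := by
    rw [hr, ← Real.rpow_mul_natCast hR0.le, ← Real.rpow_one_add' hR0.le (by nlinarith)]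
    refine Real.rpow_le_rpow_of_exponent_le hR.le ?_
    nlinarith
  refine h1.trans (add_le_add (mul_le_mul_of_nonneg_right h3 ht) ?_)
  calc √(4 * Real.pi) * ‖T R h - ∑ m ∈ Finset.range (N + 1), Q m (T R h)‖
      ≤ √(4 * Real.pi) * (B * ‖h‖ * r ^ (N + 1) / (1 - r)) := by gcongr
    _ ≤ √(4 * Real.pi) * (B * ‖h‖ * (R * R ^ (-(11 / 10 * x))) / (1 - r)) := by gcongr
    _ = _ := by ring

/-- A variational source condition for Sobolev smooth functions. -/
theorem exists_inner_le {R p : ℝ} (hR : 1 < R) (hp : 0 < p) {f : L2} (hf : MemSobolev p f) :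
    ∃ C > 0, ∃ α₀ ∈ Set.Ioo (0 : ℝ) 1, ∀ α, 0 < α → α ≤ α₀ → ∀ h : L2,
      2 * α * |inner ℝ f h| ≤ 1 / 8 * (∫ x, |T R h x| ∂surf)
        + α * (C * (-Real.log α) ^ (-p)) * ‖h‖ := by
  have hR0 : 0 < R := by linarith
  have hR1 : 0 < R - 1 := by linarith
  have hlR : 0 < Real.log R := Real.log_pos hR
  set A := R ^ 4 / (R - 1) * ‖f‖ with hA
  have hA0 : 0 ≤ A := by positivity
  set B := √(∑' m : ℕ, (1 + (m : ℝ) * ((m : ℝ) + 1)) ^ p * ‖Q m f‖ ^ 2)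
  have hB0 : 0 ≤ B := Real.sqrt_nonneg _
  -- The bound on α makes 2A√α ≤ 1/8, the coefficient wanted in front of ‖Th‖₁; the added ones in A
  -- + 1 and B + 1 cover vanishing A or B.
  refine ⟨2 * ((B + 1) * (2 * Real.log R) ^ p), by positivity, (1 / (16 * (A + 1))) ^ 2,
    ⟨by positivity, ?_⟩, fun α hα hα0 h => ?_⟩
  · refine pow_lt_one₀ (by positivity) ?_ two_ne_zero
    rw [div_lt_one (by positivity)]
    linarith
  have hsα : √α ≤ 1 / (16 * (A + 1)) := by
    rw [Real.sqrt_le_left (by positivity)]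
    exact hα0
  have hα1 : α < 1 := by
    refine hα0.trans_lt (pow_lt_one₀ (by positivity) ?_ two_ne_zero)
    rw [div_lt_one (by positivity)]
    linarith
  set L := -Real.log α with hL
  have hL0 : 0 < L := neg_pos.mpr (Real.log_neg hα hα1)
  -- This cutoff balances both parts: R^M ≤ α^(-1/2), while M + 1 is still at least a multiple of
  -- -log α.
  set M := ⌊L / (2 * Real.log R)⌋₊
  have hM1 : (M : ℝ) ≤ L / (2 * Real.log R) := Nat.floor_le (by positivity)
  have hM2 : L / (2 * Real.log R) ≤ (M : ℝ) + 1 := (Nat.lt_floor_add_one _).le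
  have hRM : α * R ^ M ≤ √α := by
    have h1 : R ^ M ≤ Real.exp (L / 2) := by
      rw [← Real.rpow_natCast, Real.rpow_def_of_pos hR0]
      refine Real.exp_le_exp.mpr ?_
      rw [le_div_iff₀ (by positivity)] at hM1
      linarith
    have h2 : Real.exp (L / 2) * √α = 1 := by
      rw [Real.sqrt_eq_rpow, Real.rpow_def_of_pos hα, ← Real.exp_add, Real.exp_eq_one_iff]
      rw [hL]
      ring
    calc α * R ^ M ≤ α * Real.exp (L / 2) := by gcongr
      _ = √α * (Real.exp (L / 2) * √α) := by
          nth_rewrite 1 [← Real.mul_self_sqrt hα.le]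
          ring
      _ = √α := by rw [h2, mul_one]
  have ht : 0 ≤ ∫ x, |T R h x| ∂surf := integral_nonneg fun x => abs_nonneg _
  set t := ∫ x, |T R h x| ∂surf
  have h1 := abs_inner_sum_Q_le hR M f h
  have h2 := norm_sub_sum_Q_le hp hf M
  have h3 : |inner ℝ f h| ≤ A * R ^ M * t + B * ((M : ℝ) + 1) ^ (-p) * ‖h‖ := by
    set u := ∑ m ∈ Finset.range (M + 1), Q m f
    have e : inner ℝ f h = inner ℝ u h + inner ℝ (f - u) h := by
      rw [← inner_add_left, add_sub_cancel]
    rw [e]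
    refine (abs_add_le _ _).trans (add_le_add (h1.trans (le_of_eq ?_))
      ((abs_real_inner_le_norm _ _).trans (mul_le_mul_of_nonneg_right h2 (norm_nonneg _))))
    rw [hA, pow_add]
    ring
  have h4 : ((M : ℝ) + 1) ^ (-p) ≤ (2 * Real.log R) ^ p * L ^ (-p) := by
    refine (Real.rpow_le_rpow_of_nonpos (by positivity) hM2 (by linarith)).trans (le_of_eq ?_)
    rw [Real.div_rpow hL0.le (by positivity), Real.rpow_neg (by positivity : 0 ≤ 2 * Real.log R),
      div_inv_eq_mul, mul_comm]
  have h5 : 2 * (A * (α * R ^ M)) ≤ 1 / 8 := by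
    have : A * (α * R ^ M) ≤ (A + 1) * (1 / (16 * (A + 1))) := by
      gcongr
      · linarith
      · exact hRM.trans hsα
    have e : (A + 1) * (1 / (16 * (A + 1))) = 1 / 16 := by field_simp
    linarith
  calc 2 * α * |inner ℝ f h|
      ≤ 2 * α * (A * R ^ M * t + B * ((M : ℝ) + 1) ^ (-p) * ‖h‖) := by gcongr
    _ = 2 * (A * (α * R ^ M)) * t + α * (2 * (B * ((M : ℝ) + 1) ^ (-p))) * ‖h‖ := by ring
    _ ≤ 1 / 8 * t + α * (2 * ((B + 1) * ((2 * Real.log R) ^ p * L ^ (-p)))) * ‖h‖ := by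
        gcongr
        linarith
    _ = _ := by ring

/-- The error estimate for Tikhonov regularization under impulsive noise. -/
theorem exists_tikhonov_error_le {R p : ℝ} (hR : 1 < R) (hp : 0 < p) {fdag : L2}
    (hf : MemSobolev p fdag) :
    ∃ C > 0, ∃ α₀ ∈ Set.Ioo (0 : ℝ) 1, ∀ η ε α : ℝ, 0 < η → η ≤ 1 → 0 ≤ ε → 0 < α → α ≤ α₀ →
      ∀ ξ : S2 → ℝ, Integrable ξ surf → ImpulsiveNoise ξ ε η → ∀ fhat : L2,
      IsTikhonovMinimizer R α (fun x => T R fdag x + ξ x) fhat →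
      (∫ x, |T R fhat x - T R fdag x| ∂surf) + α * ‖fhat - fdag‖ ^ 2 ≤
        C * (ε + R ^ (-(11 / 5 * √(Real.pi / η))) / α + α * (-Real.log α) ^ (-2 * p)) := by
  have hR0 : 0 < R := by linarith
  obtain ⟨C₁, hC₁, H₁⟩ := exists_setIntegral_T_le hR
  obtain ⟨C₂, hC₂, α₀, hα₀, H₂⟩ := exists_inner_le hR hp hf
  refine ⟨16 + 32 * C₁ ^ 2 + 8 * C₂ ^ 2, by positivity, α₀, hα₀, ?_⟩
  intro η ε α hη hη1 hε hα hαα ξ hξ hn fhat hmin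
  obtain ⟨P, hP, hPη, h0⟩ := tikhonov_basic_estimate hR hα hη hξ hn hmin
  have h1 := H₁ η hη hη1 P hPη (fhat - fdag)
  have h2 := H₂ α hα hαα (fhat - fdag)
  have e1 : ∫ x, |T R fhat x - T R fdag x| ∂surf = ∫ x, |T R (fhat - fdag) x| ∂surf := by
    refine integral_congr_ae ?_
    rw [T_sub hR]
    filter_upwards [Lp.coeFn_sub (T R fhat) (T R fdag)] with x hx
    rw [hx, Pi.sub_apply]
  rw [e1]
  have hL0 : 0 < -Real.log α := neg_pos.mpr (Real.log_neg hα (hαα.trans_lt hα₀.2))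
  have hρ : R ^ (-(11 / 5 * √(Real.pi / η))) = (R ^ (-(11 / 10 * √(Real.pi / η)))) ^ 2 := by
    rw [← Real.rpow_mul_natCast hR0.le]
    congr 1
    push_cast
    ring
  have hl : (-Real.log α) ^ (-2 * p) = ((-Real.log α) ^ (-p)) ^ 2 := by
    rw [← Real.rpow_mul_natCast hL0.le]
    congr 1
    push_cast
    ring
  rw [hρ, hl]
  set ρ := R ^ (-(11 / 10 * √(Real.pi / η)))
  set l := (-Real.log α) ^ (-p)
  have ht : 0 ≤ ∫ x, |T R (fhat - fdag) x| ∂surf := integral_nonneg fun x => abs_nonneg _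
  set t := ∫ x, |T R (fhat - fdag) x| ∂surf
  set e := ‖fhat - fdag‖
  have h3 : -(2 * α * |inner ℝ fdag (fhat - fdag)|) ≤ α * (2 * inner ℝ fdag (fhat - fdag)) := by
    have := neg_abs_le (inner ℝ fdag (fhat - fdag))
    nlinarith
  have h4 : 2 * (C₁ * ρ * e) ≤ α * e ^ 2 / 4 + 4 * C₁ ^ 2 * (ρ ^ 2 / α) := by
    have e : α * e ^ 2 / 4 + 4 * C₁ ^ 2 * (ρ ^ 2 / α) - 2 * (C₁ * ρ * e)
        = (α * e / 2 - 2 * (C₁ * ρ)) ^ 2 / α := by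
      field_simp
      ring
    have : 0 ≤ (α * ‖fhat - fdag‖ / 2 - 2 * (C₁ * ρ)) ^ 2 / α := by positivity
    linarith
  have h5 : α * (C₂ * l) * e ≤ α * e ^ 2 / 4 + α * (C₂ ^ 2 * l ^ 2) := by
    nlinarith [mul_nonneg hα.le (sq_nonneg (e / 2 - C₂ * l))]
  -- The right side of the basic estimate takes up 3/4 + 1/8 of t and 1/4 + 1/4 of αe². What
  -- remains, at least t/8 + αe²/2, is multiplied by 8.
  have h6 : t + α * e ^ 2 ≤ 16 * ε + 32 * C₁ ^ 2 * (ρ ^ 2 / α) + 8 * C₂ ^ 2 * (α * l ^ 2) := by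
    have : 0 ≤ α * e ^ 2 := by positivity
    rw [mul_add] at h0
    linarith
  have p1 : 0 ≤ ρ ^ 2 / α := by positivity
  have p2 : 0 ≤ α * l ^ 2 := by positivity
  have q1 : 0 ≤ C₁ ^ 2 := by positivity
  have q2 : 0 ≤ C₂ ^ 2 := by positivity
  nlinarith [mul_nonneg q1 hε, mul_nonneg q2 hε, mul_nonneg q1 p2, mul_nonneg q2 p1]

/-! ### The parameter choice -/

/-- A priori parameter choice for impulsive noise of parameters `(ε, η)`. -/
noncomputable def paramChoice (R p ε η : ℝ) : ℝ :=
  max (ε * (-Real.log ε) ^ (2 * p)) (η ^ (-(3 / 2) : ℝ) * R ^ (-√(Real.pi / η)))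

theorem paramChoice_pos {R : ℝ} (hR : 1 < R) (p ε : ℝ) {η : ℝ} (hη : 0 < η) :
    0 < paramChoice R p ε η :=
  lt_max_of_lt_right (by positivity)

theorem exists_mul_log_rpow_bounds {p : ℝ} (hp : 0 < p) : ∃ K > 0, ∃ ε₁ ∈ Set.Ioo (0 : ℝ) 1,
    (∀ ε, 0 ≤ ε → ε ≤ 1 → ε * (-Real.log ε) ^ (2 * p) ≤ K * √ε) ∧
    ∀ ε, 0 < ε → ε ≤ ε₁ → 1 ≤ -Real.log ε ∧
      -Real.log ε / 4 ≤ -Real.log (ε * (-Real.log ε) ^ (2 * p)) := by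
  obtain ⟨K, hK, h⟩ := exists_rpow_le_exp (2 * p) (c := 1 / 2) (by norm_num)
  have h1 : ∀ ε, 0 ≤ ε → ε ≤ 1 → ε * (-Real.log ε) ^ (2 * p) ≤ K * √ε := by
    intro ε hε hε1
    rcases hε.eq_or_lt with rfl | hε
    · simp
    have hL : 0 ≤ -Real.log ε := neg_nonneg.mpr (Real.log_nonpos hε.le hε1)
    have h2 : ε * Real.exp (1 / 2 * -Real.log ε) = √ε := by
      rw [Real.sqrt_eq_rpow, Real.rpow_def_of_pos hε]
      nth_rewrite 1 [← Real.exp_log hε]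
      rw [← Real.exp_add]
      ring_nf
    calc ε * (-Real.log ε) ^ (2 * p) ≤ ε * (K * Real.exp (1 / 2 * -Real.log ε)) :=
          mul_le_mul_of_nonneg_left (h _ hL (by positivity)) hε.le
      _ = K * √ε := by rw [← h2]; ring
  -- The logarithm of the bound K√ε gives -log ε / 2 - log K, which is at least -log ε / 4 once 4
  -- log K ≤ -log ε.
  refine ⟨K, hK, Real.exp (-(max 1 (4 * Real.log K))), ⟨Real.exp_pos _, ?_⟩, h1, ?_⟩
  · rw [Real.exp_lt_one_iff, neg_lt_zero]
    exact lt_max_of_lt_left one_pos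
  · intro ε hε hε1
    have hL : max 1 (4 * Real.log K) ≤ -Real.log ε := by
      rw [le_neg]
      exact (Real.log_le_iff_le_exp hε).mpr hε1
    have hL1 : 1 ≤ -Real.log ε := (le_max_left _ _).trans hL
    have hL2 : 4 * Real.log K ≤ -Real.log ε := (le_max_right _ _).trans hL
    refine ⟨hL1, ?_⟩
    have hε1 : ε ≤ 1 := by
      by_contra! hc
      linarith [Real.log_pos hc]
    have h2 := Real.log_le_log (by positivity) (h1 ε hε.le hε1)
    rw [Real.log_mul hK.ne' (Real.sqrt_pos.mpr hε).ne', Real.log_sqrt hε.le] at h2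
    linarith

theorem exists_rpow_mul_rpow_sqrt_bounds {R p : ℝ} (hR : 1 < R) (hp : 0 < p) :
    ∃ K > 0, ∃ η₁ ∈ Set.Ioc (0 : ℝ) 1,
    (∀ η, 0 < η → η ^ (-(3 / 2) : ℝ) * R ^ (-√(Real.pi / η)) ≤ K * η) ∧
    ∀ η, 0 < η → η ≤ η₁ →
      (-Real.log (η ^ (-(3 / 2) : ℝ) * R ^ (-√(Real.pi / η)))) ^ (-2 * p) ≤ K * η ^ p := by
  have hR0 : 0 < R := by linarith
  have hlR : 0 < Real.log R := Real.log_pos hR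
  -- Half of the exponent turns η^(-3/2) into Kη; the other half survives and, once Kη ≤ 1, bounds
  -- the logarithm from below.
  obtain ⟨K, hK, h⟩ := exists_rpow_sqrt_le (c := 1 / 2) (q := 5 / 2) hR (by norm_num) (by norm_num)
  have h1 : ∀ η, 0 < η → η ^ (-(3 / 2) : ℝ) * R ^ (-√(Real.pi / η)) ≤
      K * η * R ^ (-(1 / 2 * √(Real.pi / η))) := by
    intro η hη
    have e1 : R ^ (-√(Real.pi / η)) =
        R ^ (-(1 / 2 * √(Real.pi / η))) * R ^ (-(1 / 2 * √(Real.pi / η))) := by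
      rw [← Real.rpow_add hR0]
      ring_nf
    have e2 : η ^ (-(3 / 2) : ℝ) * η ^ (5 / 2 : ℝ) = η := by
      rw [← Real.rpow_add hη]
      norm_num
    calc η ^ (-(3 / 2) : ℝ) * R ^ (-√(Real.pi / η))
        = η ^ (-(3 / 2) : ℝ) * R ^ (-(1 / 2 * √(Real.pi / η))) *
            R ^ (-(1 / 2 * √(Real.pi / η))) := by rw [e1]; ring
      _ ≤ η ^ (-(3 / 2) : ℝ) * (K * η ^ (5 / 2 : ℝ)) * R ^ (-(1 / 2 * √(Real.pi / η))) := by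
          gcongr
          exact h η hη
      _ = K * (η ^ (-(3 / 2) : ℝ) * η ^ (5 / 2 : ℝ)) * R ^ (-(1 / 2 * √(Real.pi / η))) := by ring
      _ = _ := by rw [e2]
  refine ⟨max K ((Real.log R / 2) ^ (-2 * p)), lt_max_of_lt_left hK, min 1 K⁻¹,
    ⟨by positivity, min_le_left _ _⟩, fun η hη => ?_, fun η hη hη1 => ?_⟩
  · have h2 : R ^ (-(1 / 2 * √(Real.pi / η))) ≤ 1 :=
      Real.rpow_le_one_of_one_le_of_nonpos hR.le (by simp)
    calc _ ≤ K * η * R ^ (-(1 / 2 * √(Real.pi / η))) := h1 η hη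
      _ ≤ K * η * 1 := by gcongr
      _ ≤ _ := by
          rw [mul_one]
          gcongr
          exact le_max_left _ _
  · set x := √(Real.pi / η)
    have hπη : 0 < Real.pi / η := by positivity
    have hx : 0 < x := Real.sqrt_pos.mpr hπη
    have h2 : η ^ (-(3 / 2) : ℝ) * R ^ (-x) ≤ R ^ (-(1 / 2 * x)) := by
      refine (h1 η hη).trans (mul_le_of_le_one_left (by positivity) ?_)
      calc K * η ≤ K * K⁻¹ := by gcongr; exact hη1.trans (min_le_right _ _)
        _ = 1 := mul_inv_cancel₀ hK.ne'
    have h3 := Real.log_le_log (by positivity) h2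
    rw [Real.log_rpow hR0] at h3
    have h4 : Real.log R / 2 * x ≤ -Real.log (η ^ (-(3 / 2) : ℝ) * R ^ (-x)) := by linarith
    have h5 : x ^ (-2 * p) ≤ η ^ p := by
      rw [Real.rpow_mul hx.le, Real.rpow_neg hx.le, Real.rpow_two, Real.sq_sqrt hπη.le, inv_div]
      refine Real.rpow_le_rpow (by positivity) ?_ hp.le
      exact div_le_self hη.le (by linarith [Real.pi_gt_three])
    calc _ ≤ (Real.log R / 2 * x) ^ (-2 * p) :=
          Real.rpow_le_rpow_of_nonpos (by positivity) h4 (by linarith)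
      _ = (Real.log R / 2) ^ (-2 * p) * x ^ (-2 * p) := Real.mul_rpow (by positivity) hx.le
      _ ≤ _ := by
          gcongr
          exact le_max_right _ _

/-- The second entry of the maximum in `paramChoice` dominates the smoothing term, so their quotient
is at most 1. -/
theorem smoothing_le {R η : ℝ} (hR : 1 < R) (hη : 0 < η) :
    2 * η * smoothing R (2 * η) ≤ η ^ (-(3 / 2) : ℝ) * R ^ (-√(Real.pi / η)) := by
  have hR0 : 0 < R := by linarith
  have h1 : 2 * η * (2 * η) ^ (-(5 / 2) : ℝ) = (2 * η) ^ (-(3 / 2) : ℝ) := by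
    rw [← Real.rpow_one_add' (by positivity) (by norm_num)]
    norm_num
  have h2 : (2 * η) ^ (-(3 / 2) : ℝ) ≤ η ^ (-(3 / 2) : ℝ) :=
    Real.rpow_le_rpow_of_nonpos hη (by linarith) (by norm_num)
  have h3 : √(Real.pi / η) ≤ √(4 * Real.pi / (2 * η)) := by
    refine Real.sqrt_le_sqrt ?_
    rw [show 4 * Real.pi / (2 * η) = 2 * (Real.pi / η) by field_simp; norm_num]
    have : 0 < Real.pi / η := by positivity
    linarith
  rw [smoothing, ← mul_assoc, h1]
  gcongr
  · exact hR.le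
  · linarith

theorem tendsto_paramChoice {R p : ℝ} (hR : 1 < R) (hp : 0 < p) :
    Filter.Tendsto (fun q : ℝ × ℝ => paramChoice R p q.1 q.2)
      (nhdsWithin 0 (Set.Ici 0) ×ˢ nhdsWithin 0 (Set.Ioi 0)) (nhds 0) := by
  obtain ⟨K, hK, -, -, h1, -⟩ := exists_mul_log_rpow_bounds hp
  obtain ⟨K', hK', -, -, h2, -⟩ := exists_rpow_mul_rpow_sqrt_bounds hR hp
  have hlim : Filter.Tendsto (fun q : ℝ × ℝ => K * √q.1 + K' * q.2)
      (nhdsWithin 0 (Set.Ici 0) ×ˢ nhdsWithin 0 (Set.Ioi 0)) (nhds 0) := by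
    have hc : Continuous fun q : ℝ × ℝ => K * √q.1 + K' * q.2 := by fun_prop
    have := hc.tendsto (0, 0)
    rw [nhds_prod_eq] at this
    simp only [Real.sqrt_zero, mul_zero, add_zero] at this
    exact this.mono_left (Filter.prod_mono nhdsWithin_le_nhds nhdsWithin_le_nhds)
  have hε : ∀ᶠ ε : ℝ in nhdsWithin 0 (Set.Ici 0), 0 ≤ ε ∧ ε ≤ 1 :=
    (eventually_mem_nhdsWithin).and
      (nhdsWithin_le_nhds (Iic_mem_nhds one_pos))
  have hη : ∀ᶠ η : ℝ in nhdsWithin 0 (Set.Ioi 0), 0 < η := eventually_mem_nhdsWithin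
  refine tendsto_of_tendsto_of_tendsto_of_le_of_le' tendsto_const_nhds hlim ?_ ?_
  · filter_upwards [hε.prod_mk hη] with q hq
    exact (paramChoice_pos hR p q.1 hq.2).le
  · filter_upwards [hε.prod_mk hη] with q hq
    have a1 := h1 q.1 hq.1.1 hq.1.2
    have a2 := h2 q.2 hq.2
    have b1 : 0 ≤ K * √q.1 := by positivity
    have b2 : 0 ≤ K' * q.2 := mul_nonneg hK'.le hq.2.le
    exact max_le (by linarith) (by linarith)

/-! ### Error bounds and convergence rates -/

theorem exists_error_bound {R p : ℝ} (hR : 1 < R) (hp : 0 < p) {fdag : L2}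
    (hf : MemSobolev p fdag) :
    ∃ C > 0, ∃ η₀ > 0, ∃ α₀ ∈ Set.Ioo (0 : ℝ) 1,
      ∀ η ε α : ℝ, 0 < η → η ≤ η₀ → 0 ≤ ε → 0 < α → α ≤ α₀ →
      ∀ ξ : S2 → ℝ, Integrable ξ surf → ImpulsiveNoise ξ ε η →
      ∀ fhat : L2, IsTikhonovMinimizer R α (fun x => T R fdag x + ξ x) fhat →
        ‖fhat - fdag‖ ^ 2 ≤
            C * (ε / α + 1 / α ^ 2 * (1 / R ^ 6) * η ^ (-3 : ℝ) * R ^ (-2 * √(Real.pi / η))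
              + (-Real.log α) ^ (-2 * p)) ∧
        (∫ x, |T R fhat x - T R fdag x| ∂surf) ≤
            C * (ε + 1 / α * (1 / R ^ 6) * η ^ (-3 : ℝ) * R ^ (-2 * √(Real.pi / η))
              + α * (-Real.log α) ^ (-2 * p)) := by
  have hR0 : 0 < R := by linarith
  obtain ⟨C, hC, α₀, hα₀, H⟩ := exists_tikhonov_error_le hR hp hf
  -- R⁶ in the constant compensates 1/R⁶ in the claim, and η ≤ 1 gives η⁻³ ≥ 1, so the claimed
  -- impulsive term is weaker than the one proved.
  refine ⟨C * R ^ 6, by positivity, 1, one_pos, α₀, hα₀, ?_⟩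
  intro η ε α hη hη1 hε hα hαα ξ hξ hn fhat hmin
  have h := H η ε α hη hη1 hε hα hαα ξ hξ hn fhat hmin
  have hL0 : 0 < -Real.log α := neg_pos.mpr (Real.log_neg hα (hαα.trans_lt hα₀.2))
  have ht : 0 ≤ ∫ x, |T R fhat x - T R fdag x| ∂surf := integral_nonneg fun x => abs_nonneg _
  set t := ∫ x, |T R fhat x - T R fdag x| ∂surf
  set l := (-Real.log α) ^ (-2 * p)
  have hl : 0 ≤ l := by positivity
  set D := η ^ (-3 : ℝ) * R ^ (-2 * √(Real.pi / η)) with hD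
  have hρ : R ^ (-(11 / 5 * √(Real.pi / η))) ≤ D := by
    have h1 : R ^ (-(11 / 5 * √(Real.pi / η))) ≤ R ^ (-2 * √(Real.pi / η)) :=
      Real.rpow_le_rpow_of_exponent_le hR.le (by linarith [Real.sqrt_nonneg (Real.pi / η)])
    exact h1.trans (le_mul_of_one_le_left (by positivity)
      (Real.one_le_rpow_of_pos_of_le_one_of_nonpos hη hη1 (by norm_num)))
  have hR6 : 1 ≤ R ^ 6 := one_le_pow₀ hR.le
  have hmain : t + α * ‖fhat - fdag‖ ^ 2 ≤
      C * R ^ 6 * (ε + 1 / α * (1 / R ^ 6) * D + α * l) := by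
    calc t + α * ‖fhat - fdag‖ ^ 2 ≤ C * (1 * ε + D / α + 1 * (α * l)) := by
          refine h.trans ?_
          rw [one_mul, one_mul]
          gcongr
      _ ≤ C * (R ^ 6 * ε + D / α + R ^ 6 * (α * l)) := by gcongr
      _ = _ := by field_simp
  have ha : 0 ≤ α * ‖fhat - fdag‖ ^ 2 := by positivity
  constructor
  · rw [← mul_le_mul_iff_right₀ hα, mul_assoc _ (η ^ (-3 : ℝ)) _, ← hD]
    refine (le_trans (by linarith) hmain).trans (le_of_eq ?_)
    field_simp
  · rw [mul_assoc _ (η ^ (-3 : ℝ)) _, ← hD]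
    linarith

theorem paramChoice_bounds {R p : ℝ} (hR : 1 < R) (hp : 0 < p) :
    ∃ K > 0, ∃ ε₁ ∈ Set.Ioo (0 : ℝ) 1, ∃ η₁ ∈ Set.Ioc (0 : ℝ) 1,
      ∀ ε η : ℝ, 0 ≤ ε → ε ≤ ε₁ → 0 < η → η ≤ η₁ →
        √(2 * ε / paramChoice R p ε η) ≤ K ∧
        ε ≤ paramChoice R p ε η * (-Real.log ε) ^ (-2 * p) ∧
        (-Real.log (paramChoice R p ε η)) ^ (-2 * p) ≤
          K * max ((-Real.log ε) ^ (-2 * p)) (η ^ p) ∧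
        paramChoice R p ε η * (-Real.log (paramChoice R p ε η)) ^ (-2 * p) ≤
          K * max ε (η ^ ((2 * p - 3) / 2) * R ^ (-√(Real.pi / η))) := by
  have hR0 : 0 < R := by linarith
  obtain ⟨-, -, ε₁, hε₁, -, h1⟩ := exists_mul_log_rpow_bounds hp
  obtain ⟨K, hK, η₁, hη₁, -, h2⟩ := exists_rpow_mul_rpow_sqrt_bounds hR hp
  refine ⟨√2 + 4 ^ (2 * p) + K, by positivity, ε₁, hε₁, η₁, hη₁, ?_⟩
  intro ε η hε hε1 hη hη1
  have hα := paramChoice_pos hR p ε hη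
  have hcases : paramChoice R p ε η = ε * (-Real.log ε) ^ (2 * p) ∨
    paramChoice R p ε η = η ^ (-(3 / 2) : ℝ) * R ^ (-√(Real.pi / η)) := max_choice _ _
  have hge : ε * (-Real.log ε) ^ (2 * p) ≤ paramChoice R p ε η := le_max_left _ _
  set α := paramChoice R p ε η
  have hL0 : 0 ≤ -Real.log ε :=
    neg_nonneg.mpr (Real.log_nonpos hε (hε1.trans hε₁.2.le))
  have hε2 : ε ≤ α * (-Real.log ε) ^ (-2 * p) := by
    rcases hε.eq_or_lt with rfl | hε
    · positivity
    · have hL : 0 < -Real.log ε := by linarith [(h1 ε hε hε1).1]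
      have e : ε = ε * (-Real.log ε) ^ (2 * p) * (-Real.log ε) ^ (-2 * p) := by
        rw [mul_assoc, ← Real.rpow_add hL]
        simp
      nth_rewrite 1 [e]
      gcongr
  have hK0 : 0 ≤ √2 := Real.sqrt_nonneg 2
  have h40 : (0 : ℝ) ≤ 4 ^ (2 * p) := by positivity
  have hm0 : 0 ≤ max ((-Real.log ε) ^ (-2 * p)) (η ^ p) := le_max_of_le_right (by positivity)
  have hM0 : 0 ≤ max ε (η ^ ((2 * p - 3) / 2) * R ^ (-√(Real.pi / η))) := le_max_of_le_left hε
  refine ⟨?_, hε2, ?_⟩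
  · have h3 : 2 * ε / α ≤ 2 := by
      rw [div_le_iff₀ hα]
      rcases hε.eq_or_lt with rfl | hε
      · linarith
      · have hL1 : (-Real.log ε) ^ (-2 * p) ≤ 1 :=
          Real.rpow_le_one_of_one_le_of_nonpos (h1 ε hε hε1).1 (by linarith)
        nlinarith
    linarith [Real.sqrt_le_sqrt h3]
  · rcases hcases with hc | hc
    · have hεpos : 0 < ε := by
        rcases hε.eq_or_lt with rfl | hε
        -- For ε = 0 the first entry of the maximum is 0, contradicting positivity of the parameter.
        · simp at hc
          exact absurd hc hα.ne'
        · exact hε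
      obtain ⟨hL1, hL4⟩ := h1 ε hεpos hε1
      have hL : 0 < -Real.log ε := by linarith
      rw [← hc] at hL4
      have h3 : (-Real.log α) ^ (-2 * p) ≤ 4 ^ (2 * p) * (-Real.log ε) ^ (-2 * p) := by
        refine (Real.rpow_le_rpow_of_nonpos (by positivity) hL4 (by linarith)).trans (le_of_eq ?_)
        rw [Real.div_rpow hL.le (by norm_num), neg_mul, Real.rpow_neg (by norm_num : (0 : ℝ) ≤ 4),
          div_inv_eq_mul, mul_comm]
      constructor
      · refine h3.trans (mul_le_mul (by linarith) (le_max_left _ _) (by positivity) (by positivity))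
      · calc α * (-Real.log α) ^ (-2 * p)
            ≤ α * (4 ^ (2 * p) * (-Real.log ε) ^ (-2 * p)) := by gcongr
          _ = 4 ^ (2 * p) * (ε * ((-Real.log ε) ^ (2 * p) * (-Real.log ε) ^ (-2 * p))) := by
              rw [hc]; ring
          _ = 4 ^ (2 * p) * ε := by
              rw [← Real.rpow_add hL]
              simp
          _ ≤ _ := mul_le_mul (by linarith) (le_max_left _ _) hε (by positivity)
    · have h3 := h2 η hη hη1
      rw [← hc] at h3
      constructor
      · exact h3.trans (mul_le_mul (by linarith) (le_max_right _ _) (by positivity) (by positivity))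
      · calc α * (-Real.log α) ^ (-2 * p) ≤ α * (K * η ^ p) := by gcongr
          _ = K * (η ^ (-(3 / 2) : ℝ) * η ^ p * R ^ (-√(Real.pi / η))) := by rw [hc]; ring
          _ = K * (η ^ ((2 * p - 3) / 2) * R ^ (-√(Real.pi / η))) := by
              rw [← Real.rpow_add hη]
              ring_nf
          _ ≤ _ := mul_le_mul (by linarith) (le_max_right _ _) (by positivity) (by positivity)

/-- With x = √(π/η), split 11/5 = 1 + 1 + 1/5: each factor R^(-x) is at most the parameter α, and
the surplus R^(-x/5) supplies η^p for every p. -/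
theorem exists_impulsive_term_le {R p : ℝ} (hR : 1 < R) (hp : 0 < p) :
    ∃ K > 0, ∀ ε η : ℝ, 0 < η → η ≤ 1 →
      R ^ (-(11 / 5 * √(Real.pi / η))) / paramChoice R p ε η ≤
        paramChoice R p ε η * (K * η ^ p) ∧
      R ^ (-(11 / 5 * √(Real.pi / η))) / paramChoice R p ε η ≤
        K * (η ^ ((2 * p - 3) / 2) * R ^ (-√(Real.pi / η))) := by
  have hR0 : 0 < R := by linarith
  obtain ⟨K, hK, h⟩ := exists_rpow_sqrt_le (c := 1 / 5) hR (by norm_num) hp.le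
  refine ⟨K, hK, fun ε η hη hη1 => ?_⟩
  have hα := paramChoice_pos hR p ε hη
  have hge : η ^ (-(3 / 2) : ℝ) * R ^ (-√(Real.pi / η)) ≤ paramChoice R p ε η := le_max_right _ _
  set α := paramChoice R p ε η
  set x := √(Real.pi / η)
  have hη3 : 1 ≤ η ^ (-(3 / 2) : ℝ) :=
    Real.one_le_rpow_of_pos_of_le_one_of_nonpos hη hη1 (by norm_num)
  have hge2 : R ^ (-x) ≤ α := (le_mul_of_one_le_left (by positivity) hη3).trans hge
  have e : R ^ (-(11 / 5 * x)) = R ^ (-x) * R ^ (-x) * R ^ (-(1 / 5 * x)) := by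
    rw [← Real.rpow_add hR0, ← Real.rpow_add hR0]
    ring_nf
  have hρ : R ^ (-(11 / 5 * x)) ≤ R ^ (-x) * R ^ (-x) * (K * η ^ p) := by
    rw [e]
    gcongr
    exact h η hη
  constructor <;> rw [div_le_iff₀ hα]
  · calc _ ≤ R ^ (-x) * R ^ (-x) * (K * η ^ p) := hρ
      _ ≤ α * α * (K * η ^ p) := by gcongr
      _ = _ := by ring
  · have hpow : η ^ p ≤ η ^ ((2 * p - 3) / 2) :=
      Real.rpow_le_rpow_of_exponent_ge hη hη1 (by linarith)
    calc _ ≤ R ^ (-x) * R ^ (-x) * (K * η ^ p) := hρ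
      _ ≤ R ^ (-x) * α * (K * η ^ ((2 * p - 3) / 2)) := by gcongr
      _ = _ := by ring

theorem exists_convergence_rate {R p : ℝ} (hR : 1 < R) (hp : 0 < p) {fdag : L2}
    (hf : MemSobolev p fdag) :
    ∃ K > 0, ∃ ε₁ > 0, ∃ η₁ > 0,
      ∀ ε η : ℝ, 0 ≤ ε → ε ≤ ε₁ → 0 < η → η ≤ η₁ →
        0 < paramChoice R p ε η ∧
        √(2 * ε / paramChoice R p ε η) + 2 * η * smoothing R (2 * η) / paramChoice R p ε η ≤ K ∧
        ∀ ξ : S2 → ℝ, Integrable ξ surf → ImpulsiveNoise ξ ε η →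
        ∀ fhat : L2,
          IsTikhonovMinimizer R (paramChoice R p ε η) (fun x => T R fdag x + ξ x) fhat →
          ‖fhat - fdag‖ ^ 2 ≤ K * max ((-Real.log ε) ^ (-2 * p)) (η ^ p) ∧
          (∫ x, |T R fhat x - T R fdag x| ∂surf) ≤
            K * max ε (η ^ ((2 * p - 3) / 2) * R ^ (-√(Real.pi / η))) := by
  obtain ⟨C, hC, α₀, hα₀, H⟩ := exists_tikhonov_error_le hR hp hf
  obtain ⟨K₁, hK₁, ε₁, hε₁, η₁, hη₁, h1⟩ := paramChoice_bounds hR hp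
  obtain ⟨K₂, hK₂, h2⟩ := exists_impulsive_term_le hR hp
  obtain ⟨K₃, hK₃, -, -, h3, -⟩ := exists_mul_log_rpow_bounds hp
  obtain ⟨K₄, hK₄, -, -, h4, -⟩ := exists_rpow_mul_rpow_sqrt_bounds hR hp
  have hα₀p : 0 < α₀ := hα₀.1
  -- The thresholds α₀/K₃ for √ε and α₀/K₄ for η force both entries of the maximum, hence the
  -- parameter, below α₀.
  refine ⟨C * (1 + K₂ + K₁) + (K₁ + 1), by positivity, min ε₁ ((α₀ / K₃) ^ 2),
    lt_min hε₁.1 (by positivity), min η₁ (α₀ / K₄), lt_min hη₁.1 (by positivity), ?_⟩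
  intro ε η hε hε1 hη hη1
  have hε2 := hε1.trans (min_le_left _ _)
  have hη2 := hη1.trans (min_le_left _ _)
  have hη3 : η ≤ 1 := hη2.trans hη₁.2
  have hα := paramChoice_pos hR p ε hη
  obtain ⟨a1, a2, a3, a4⟩ := h1 ε η hε hε2 hη hη2
  obtain ⟨b1, b2⟩ := h2 ε η hη hη3
  have hαα : paramChoice R p ε η ≤ α₀ := by
    refine max_le ((h3 ε hε (hε2.trans hε₁.2.le)).trans ?_) ((h4 η hη).trans ?_)
    · have : √ε ≤ α₀ / K₃ := by
        rw [Real.sqrt_le_left (by positivity)]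
        exact hε1.trans (min_le_right _ _)
      rwa [le_div_iff₀' hK₃] at this
    · have := hη1.trans (min_le_right _ _)
      rwa [le_div_iff₀' hK₄] at this
  have hge : η ^ (-(3 / 2) : ℝ) * R ^ (-√(Real.pi / η)) ≤ paramChoice R p ε η := le_max_right _ _
  set α := paramChoice R p ε η
  refine ⟨hα, ?_, ?_⟩
  · have : 2 * η * smoothing R (2 * η) / α ≤ 1 :=
      (div_le_one hα).mpr ((smoothing_le hR hη).trans hge)
    have : 0 ≤ C * (1 + K₂ + K₁) := by positivity
    linarith
  · intro ξ hξ hn fhat hmin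
    have h := H η ε α hη hη3 hε hα hαα ξ hξ hn fhat hmin
    have ht : 0 ≤ ∫ x, |T R fhat x - T R fdag x| ∂surf := integral_nonneg fun x => abs_nonneg _
    set t := ∫ x, |T R fhat x - T R fdag x| ∂surf
    set m := max ((-Real.log ε) ^ (-2 * p)) (η ^ p)
    set M := max ε (η ^ ((2 * p - 3) / 2) * R ^ (-√(Real.pi / η)))
    have hm1 : (-Real.log ε) ^ (-2 * p) ≤ m := le_max_left _ _
    have hm2 : η ^ p ≤ m := le_max_right _ _
    have hM1 : ε ≤ M := le_max_left _ _
    have hM2 : η ^ ((2 * p - 3) / 2) * R ^ (-√(Real.pi / η)) ≤ M := le_max_right _ _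
    have hm0 : 0 ≤ m := le_trans (by positivity) hm2
    have hM0 : 0 ≤ M := hε.trans hM1
    have hK0 : 0 ≤ K₁ + 1 := by positivity
    constructor
    · have h5 : α * ‖fhat - fdag‖ ^ 2 ≤ α * (C * (1 + K₂ + K₁) * m) := by
        calc α * ‖fhat - fdag‖ ^ 2 ≤ C * (α * (-Real.log ε) ^ (-2 * p) + α * (K₂ * η ^ p)
              + α * (K₁ * m)) := by
              refine le_trans (by linarith) (h.trans ?_)
              gcongr
          _ ≤ C * (α * m + α * (K₂ * m) + α * (K₁ * m)) := by gcongr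
          _ = _ := by ring
      refine (le_of_mul_le_mul_left h5 hα).trans (mul_le_mul_of_nonneg_right ?_ hm0)
      linarith
    · have h5 : t ≤ C * (1 + K₂ + K₁) * M := by
        calc t ≤ C * (M + K₂ * (η ^ ((2 * p - 3) / 2) * R ^ (-√(Real.pi / η))) + K₁ * M) := by
              have : 0 ≤ α * ‖fhat - fdag‖ ^ 2 := by positivity
              refine le_trans (by linarith) (h.trans ?_)
              gcongr
          _ ≤ C * (M + K₂ * M + K₁ * M) := by gcongr
          _ = _ := by ring
      refine h5.trans (mul_le_mul_of_nonneg_right ?_ hM0)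
      linarith

end Gradiometry

theorem theorem4p4 (R : ℝ) (hR : 1 < R) (p : ℝ) (hp : 0 < p)
    (fdag : Gradiometry.L2) (hf : Gradiometry.MemSobolev p fdag) :
    -- error and residual bounds
    (∃ C > 0, ∃ η₀ > 0, ∃ α₀ ∈ Set.Ioo (0 : ℝ) 1,
      ∀ η ε α : ℝ, 0 < η → η ≤ η₀ → 0 ≤ ε → 0 < α → α ≤ α₀ →
      ∀ ξ : Gradiometry.S2 → ℝ, MeasureTheory.Integrable ξ Gradiometry.surf →
        Gradiometry.ImpulsiveNoise ξ ε η →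
      ∀ fhat : Gradiometry.L2,
        Gradiometry.IsTikhonovMinimizer R α (fun x => Gradiometry.T R fdag x + ξ x) fhat →
        ‖fhat - fdag‖ ^ 2 ≤
            C * (ε / α + 1 / α ^ 2 * (1 / R ^ 6) * η ^ (-3 : ℝ) * R ^ (-2 * √(Real.pi / η))
              + (-Real.log α) ^ (-2 * p)) ∧
        (∫ x, |Gradiometry.T R fhat x - Gradiometry.T R fdag x| ∂Gradiometry.surf) ≤
            C * (ε + 1 / α * (1 / R ^ 6) * η ^ (-3 : ℝ) * R ^ (-2 * √(Real.pi / η))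
              + α * (-Real.log α) ^ (-2 * p))) ∧
    -- a-priori parameter choice and convergence rates
    -- (for `ε = 0` the expression `(-Real.log ε) ^ (-2 * p)` takes its limit value `0`)
    (∃ αbar : ℝ → ℝ → ℝ,
      Filter.Tendsto (fun q : ℝ × ℝ => αbar q.1 q.2)
        (nhdsWithin 0 (Set.Ici 0) ×ˢ nhdsWithin 0 (Set.Ioi 0)) (nhds 0) ∧
      ∃ K > 0, ∃ ε₁ > 0, ∃ η₁ > 0,
      ∀ ε η : ℝ, 0 ≤ ε → ε ≤ ε₁ → 0 < η → η ≤ η₁ →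
        0 < αbar ε η ∧
        √(2 * ε / αbar ε η) + 2 * η * Gradiometry.smoothing R (2 * η) / αbar ε η ≤ K ∧
        ∀ ξ : Gradiometry.S2 → ℝ, MeasureTheory.Integrable ξ Gradiometry.surf →
          Gradiometry.ImpulsiveNoise ξ ε η →
        ∀ fhat : Gradiometry.L2,
          Gradiometry.IsTikhonovMinimizer R (αbar ε η)
            (fun x => Gradiometry.T R fdag x + ξ x) fhat →
          ‖fhat - fdag‖ ^ 2 ≤ K * max ((-Real.log ε) ^ (-2 * p)) (η ^ p) ∧
          (∫ x, |Gradiometry.T R fhat x - Gradiometry.T R fdag x| ∂Gradiometry.surf) ≤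
            K * max ε (η ^ ((2 * p - 3) / 2) * R ^ (-√(Real.pi / η)))) := by
  exact ⟨Gradiometry.exists_error_bound hR hp hf, Gradiometry.paramChoice R p,
    Gradiometry.tendsto_paramChoice hR hp, Gradiometry.exists_convergence_rate hR hp hf⟩
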